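/- Let $(M,\phi,\xi,\eta,g)$ be a $(2n+1)$-dimensional Kenmotsu manifold, i.e. $M$ is a smooth manifold of dimension $2n+1$, $g$ a Riemannian metric with Levi-Civita connection $\nabla$, $\phi$ a $(1,1)$-tensor field, $\xi$ a vector field and $\eta$ a $1$-form (all smooth) such that $$\phi^2=-I+\eta\otimes\xi,\quad \eta(\xi)=1,\quad \eta=g(\xi,\cdot),\quad g(\phi X,\phi Y)=g(X,Y)-\eta(X)\eta(Y),\quad (\nabla_X\phi)Y=g(\phi X,Y)\xi-\eta(Y)\phi X$$ for all smooth vector fields $X,Y$. Let $a>0$ be a constant and let $$\overline{\phi}=\phi,\quad \overline{\xi}=\tfrac1a\xi,\quad \overline{\eta}=a\eta,\quad \overline{g}=ag+a(a-1)\eta\otimes\eta$$ be the $D$-homothetically deformed structure. Let $f$ and $\overline{\lambda}$ be smooth functions on $M$ such that $V=\overline{\mathrm{grad}}(f)$, the gradient of $f$ with respect to $\overline{g}$, and $\overline{\lambda}$ define a gradient almost Ricci soliton on $(M,\overline{g})$, i.e. $$\tfrac12\mathcal{L}_V\overline{g}+\overline{\mathrm{Ric}}=\overline{\lambda}\,\overline{g},$$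 where $\overline{\mathrm{Ric}}$ is the Ricci tensor of $\overline{g}$. Then at every point of $M$ $$\begin{aligned} |\mathrm{Ric}|_g^2\ \geq\ & |\mathrm{Hess}(f)|_g^2-4n\frac{a-1}{a}\,\mathrm{scal}-4n^2(2n+1)\Big(\frac{a-1}{a}\Big)^2-\frac{1}{2n+1}(\Delta(f))^2\\ &-\frac{2}{2n+1}\,\frac{a-1}{a}\,[\xi(f)-\xi(\xi(f))]\,\Delta(f)+\frac{2(2n+a)(a-1)}{(2n+1)a^2}\,\xi(f)\,\xi(\xi(f))\\ &+\frac{2n}{2n+1}\Big(\frac{a-1}{a}\Big)^2(\xi(f))^2-\frac{2(n+na+a)(a-1)}{(2n+1)a^2}\,(\xi(\xi(f)))^2, \end{aligned}$$ where $\mathrm{Ric}$, $\mathrm{scal}$, $\mathrm{Hess}$ and $\Delta=\mathrm{div}\circ\mathrm{grad}$ are the Ricci tensor, the scalar curvature, the Hessian and the Laplacian of the original metric $g$, and $|\cdot|_g$ is the Hilbert-Schmidt norm with respect to $g$. -/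

import Mathlib

theorem Kenmotsu.contDiff_smulRight_self (E : Type*) [NormedAddCommGroup E] [NormedSpace ℝ E] :
    ContDiff ℝ (⊤ : ℕ∞) (fun α : E →L[ℝ] ℝ ↦ α.smulRight α) :=
  ContDiff.comp (g := fun p : (E →L[ℝ] ℝ) × (E →L[ℝ] ℝ) ↦ p.1.smulRight p.2)
    isBoundedBilinearMap_smulRight.contDiff (contDiff_id.prodMk contDiff_id)

open Bundle Module Set FiberBundle VectorField
open scoped Manifold ContDiff Topology

noncomputable section

namespace Kenmotsu

section Riemannian

variable {E : Type*} [NormedAddCommGroup E] [NormedSpace ℝ E] [FiniteDimensional ℝ E]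
  {M : Type*} [TopologicalSpace M] [ChartedSpace E M] [IsManifold 𝓘(ℝ, E) ∞ M]

/-- Smooth Riemannian metrics on `M`. -/
abbrev Metric (E : Type*) [NormedAddCommGroup E] [NormedSpace ℝ E] [FiniteDimensional ℝ E]
    (M : Type*) [TopologicalSpace M] [ChartedSpace E M] [IsManifold 𝓘(ℝ, E) ∞ M] :=
  ContMDiffRiemannianMetric 𝓘(ℝ, E) ∞ E (fun x : M ↦ TangentSpace 𝓘(ℝ, E) x)

/-- Vector fields on `M` (smoothness is a separate hypothesis, see `IsSmooth`). -/
abbrev VField (E : Type*) [NormedAddCommGroup E] [NormedSpace ℝ E]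
    (M : Type*) [TopologicalSpace M] [ChartedSpace E M] :=
  Π x : M, TangentSpace 𝓘(ℝ, E) x

/-- The vector field `X` is smooth. -/
def IsSmooth (X : VField E M) : Prop :=
  ContMDiff 𝓘(ℝ, E) 𝓘(ℝ, E).tangent ∞ (fun x ↦ (X x : TangentBundle 𝓘(ℝ, E) M))

/-- The vector field `X` is differentiable at `x`. -/
abbrev DiffAt (X : VField E M) (x : M) : Prop :=
  MDifferentiableAt 𝓘(ℝ, E) 𝓘(ℝ, E).tangent (fun x ↦ (X x : TangentBundle 𝓘(ℝ, E) M)) x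

theorem mdifferentiableAt_inner (g : Metric E M) {X Y : VField E M} {x : M}
    (hX : DiffAt X x) (hY : DiffAt Y x) :
    MDifferentiableAt 𝓘(ℝ, E) 𝓘(ℝ, ℝ) (fun y ↦ g.inner y (X y) (Y y)) x := by
  let _ : RiemannianBundle (fun x : M ↦ TangentSpace 𝓘(ℝ, E) x) := ⟨g.toRiemannianMetric⟩
  exact MDifferentiableAt.inner_bundle (F := E) (E := fun x : M ↦ TangentSpace 𝓘(ℝ, E) x) hX hY

theorem exists_orthonormal (g : Metric E M) (x : M) :
    ∃ e : Basis (Fin (finrank ℝ E)) ℝ (TangentSpace 𝓘(ℝ, E) x),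
      ∀ i j, g.inner x (e i) (e j) = if i = j then 1 else 0 := by
  let _ : RiemannianBundle (fun x : M ↦ TangentSpace 𝓘(ℝ, E) x) := ⟨g.toRiemannianMetric⟩
  have : FiniteDimensional ℝ (TangentSpace 𝓘(ℝ, E) x) := inferInstanceAs (FiniteDimensional ℝ E)
  let b := stdOrthonormalBasis ℝ (TangentSpace 𝓘(ℝ, E) x)
  have h : ∀ i j, inner ℝ (b.toBasis i) (b.toBasis j) = if i = j then (1 : ℝ) else 0 := fun i j ↦ by
    simpa using orthonormal_iff_ite.1 b.orthonormal i j
  exact ⟨b.toBasis, h⟩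

/-- A `g`-orthonormal basis of the tangent space at `x`. -/
def frame (g : Metric E M) (x : M) : Basis (Fin (finrank ℝ E)) ℝ (TangentSpace 𝓘(ℝ, E) x) :=
  (exists_orthonormal g x).choose

theorem inner_frame (g : Metric E M) (x : M) (i j : Fin (finrank ℝ E)) :
    g.inner x (frame g x i) (frame g x j) = if i = j then 1 else 0 :=
  (exists_orthonormal g x).choose_spec i j

/-- The vector `g`-dual to a covector. -/
def sharp (g : Metric E M) (x : M) :
    (TangentSpace 𝓘(ℝ, E) x →L[ℝ] ℝ) →ₗ[ℝ] TangentSpace 𝓘(ℝ, E) x where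
  toFun α := ∑ i, α (frame g x i) • frame g x i
  map_add' α β := by simp [add_smul, Finset.sum_add_distrib]
  map_smul' c α := by simp [mul_smul, Finset.smul_sum]

theorem inner_sharp (g : Metric E M) (x : M) (α : TangentSpace 𝓘(ℝ, E) x →L[ℝ] ℝ)
    (v : TangentSpace 𝓘(ℝ, E) x) : g.inner x (sharp g x α) v = α v := by
  have h : (g.inner x (sharp g x α) : TangentSpace 𝓘(ℝ, E) x →ₗ[ℝ] ℝ) = α := by
    refine (frame g x).ext fun j ↦ ?_
    simp [sharp, inner_frame]
  exact congrArg (fun l : TangentSpace 𝓘(ℝ, E) x →ₗ[ℝ] ℝ ↦ l v) h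

/-- The right-hand side of the Koszul formula, i.e. `2 g(∇_X Y, Z)`. -/
def koszul (g : Metric E M) (X Y Z : VField E M) (x : M) : ℝ :=
  d% (fun y ↦ g.inner y (Y y) (Z y)) x (X x) + d% (fun y ↦ g.inner y (X y) (Z y)) x (Y x)
    - d% (fun y ↦ g.inner y (X y) (Y y)) x (Z x)
    + g.inner x (mlieBracket 𝓘(ℝ, E) X Y x) (Z x)
    - g.inner x (mlieBracket 𝓘(ℝ, E) X Z x) (Y x)
    - g.inner x (mlieBracket 𝓘(ℝ, E) Y Z x) (X x)

theorem koszul_tensorial_left (g : Metric E M) {Y : VField E M} {x : M} (hY : DiffAt Y x)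
    (Z : VField E M) (hZ : DiffAt Z x) :
    TensorialAt 𝓘(ℝ, E) E (fun X : VField E M ↦ koszul g X Y Z x) x where
  smul {f X} hf hX := by
    simp [koszul, mlieBracket_smul_left hf hX,
      mvfderiv_fun_mul hf (mdifferentiableAt_inner g hX hZ),
      mvfderiv_fun_mul hf (mdifferentiableAt_inner g hX hY)]
    ring
  add {X X'} hX hX' := by
    simp [koszul, mlieBracket_add_left hX hX',
      mvfderiv_fun_add (mdifferentiableAt_inner g hX hZ) (mdifferentiableAt_inner g hX' hZ),
      mvfderiv_fun_add (mdifferentiableAt_inner g hX hY) (mdifferentiableAt_inner g hX' hY)]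
    ring

theorem koszul_tensorial_right (g : Metric E M) {Y : VField E M} {x : M} (hY : DiffAt Y x)
    (X : VField E M) (hX : DiffAt X x) :
    TensorialAt 𝓘(ℝ, E) E (fun Z : VField E M ↦ koszul g X Y Z x) x where
  smul {f Z} hf hZ := by
    simp [koszul, mlieBracket_smul_right hf hZ,
      mvfderiv_fun_mul hf (mdifferentiableAt_inner g hX hZ),
      mvfderiv_fun_mul hf (mdifferentiableAt_inner g hY hZ),
      g.symm x (Z x) (X x), g.symm x (Z x) (Y x)]
    ring
  add {Z Z'} hZ hZ' := by
    simp [koszul, mlieBracket_add_right hZ hZ',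
      mvfderiv_fun_add (mdifferentiableAt_inner g hX hZ) (mdifferentiableAt_inner g hX hZ'),
      mvfderiv_fun_add (mdifferentiableAt_inner g hY hZ) (mdifferentiableAt_inner g hY hZ')]
    ring

/-- `2 g(∇_X Y, Z)` as a bilinear form in the values of `X` and `Z` at `x`. -/
def koszulForm (g : Metric E M) (Y : VField E M) (x : M) (hY : DiffAt Y x) :
    TangentSpace 𝓘(ℝ, E) x →L[ℝ] TangentSpace 𝓘(ℝ, E) x →L[ℝ] ℝ :=
  TensorialAt.mkHom₂ (fun X Z : VField E M ↦ koszul g X Y Z x) x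
    (fun Z hZ ↦ koszul_tensorial_left g hY Z hZ) (fun X hX ↦ koszul_tensorial_right g hY X hX)

theorem koszulForm_apply (g : Metric E M) {X Y Z : VField E M} {x : M} (hX : DiffAt X x)
    (hY : DiffAt Y x) (hZ : DiffAt Z x) :
    koszulForm g Y x hY (X x) (Z x) = koszul g X Y Z x :=
  TensorialAt.mkHom₂_apply _ _ hX hZ

open Classical in
/-- The covariant derivative `v ↦ ∇_v Y` at `x` determined by the Koszul formula. -/
def koszulNabla (g : Metric E M) (Y : VField E M) (x : M) :
    TangentSpace 𝓘(ℝ, E) x →L[ℝ] TangentSpace 𝓘(ℝ, E) x :=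
  if hY : DiffAt Y x then
    haveI : FiniteDimensional ℝ (TangentSpace 𝓘(ℝ, E) x) := inferInstanceAs (FiniteDimensional ℝ E)
    haveI : T2Space (TangentSpace 𝓘(ℝ, E) x) := inferInstanceAs (T2Space E)
    LinearMap.toContinuousLinearMap
      (sharp g x ∘ₗ ((1 / 2 : ℝ) • (koszulForm g Y x hY).toLinearMap))
  else 0

theorem inner_koszulNabla (g : Metric E M) {X Y Z : VField E M} {x : M} (hX : DiffAt X x)
    (hY : DiffAt Y x) (hZ : DiffAt Z x) :
    g.inner x (koszulNabla g Y x (X x)) (Z x) = 1 / 2 * koszul g X Y Z x := by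
  simp [koszulNabla, hY, inner_sharp, koszulForm_apply g hX hY hZ]

theorem inner_ext (g : Metric E M) (x : M) {u v : TangentSpace 𝓘(ℝ, E) x}
    (h : ∀ w, g.inner x u w = g.inner x v w) : u = v := by
  by_contra hne
  have h1 := g.pos x (u - v) (sub_ne_zero.2 hne)
  simp [h] at h1

theorem diffAt_extend {x : M} (v : TangentSpace 𝓘(ℝ, E) x) :
    DiffAt (extend E v) x :=
  mdifferentiableAt_extend (I := 𝓘(ℝ, E)) (F := E) v

/-- The Levi-Civita connection of `g`. The value `leviCivita g Y x v` is `∇_v Y` at `x`. -/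
def leviCivita (g : Metric E M) :
    CovariantDerivative 𝓘(ℝ, E) E (TangentSpace 𝓘(ℝ, E) : M → Type _) where
  toFun := koszulNabla g
  isCovariantDerivativeOnUniv :=
    { add := by
        intro Y Y' x hY hY' _
        ext v
        refine inner_ext g x fun w ↦ ?_
        have hv := diffAt_extend v
        have hw := diffAt_extend w
        have h1 := inner_koszulNabla g hv hY hw
        have h2 := inner_koszulNabla g hv hY' hw
        have h3 := inner_koszulNabla g hv (mdifferentiableAt_add_section hY hY') hw
        simp only [extend_apply_self] at h1 h2 h3
        simp only [add_apply, map_add, h1, h2, h3]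
        simp [koszul, mlieBracket_add_left hY hY', mlieBracket_add_right hY hY',
          mvfderiv_fun_add (mdifferentiableAt_inner g hv hY) (mdifferentiableAt_inner g hv hY'),
          mvfderiv_fun_add (mdifferentiableAt_inner g hY hw) (mdifferentiableAt_inner g hY' hw)]
        ring
      leibniz := by
        intro Y f x hY hf _
        ext v
        refine inner_ext g x fun w ↦ ?_
        have hv := diffAt_extend v
        have hw := diffAt_extend w
        have h1 := inner_koszulNabla g hv hY hw
        have h3 := inner_koszulNabla g hv (hf.smul_section hY) hw
        simp only [extend_apply_self] at h1 h3
        change g.inner x (koszulNabla g (f • Y) x v) w = _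
        rw [h3]
        simp [h1, koszul, mlieBracket_smul_left hf hY, mlieBracket_smul_right hf hY,
          mvfderiv_fun_mul hf (mdifferentiableAt_inner g hv hY),
          mvfderiv_fun_mul hf (mdifferentiableAt_inner g hY hw), g.symm x v (Y x)]
        ring }

/-- `D` is the Levi-Civita connection of `g`: it is torsion-free and compatible with `g`. -/
structure IsLeviCivita (g : Metric E M)
    (D : CovariantDerivative 𝓘(ℝ, E) E (TangentSpace 𝓘(ℝ, E) : M → Type _)) : Prop where
  torsion_free : ∀ (X Y : VField E M) (x : M), DiffAt X x → DiffAt Y x →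
    D Y x (X x) - D X x (Y x) = mlieBracket 𝓘(ℝ, E) X Y x
  metric : ∀ (Y Z : VField E M) (x : M), DiffAt Y x → DiffAt Z x →
    ∀ v : TangentSpace 𝓘(ℝ, E) x,
      d% (fun y ↦ g.inner y (Y y) (Z y)) x v =
        g.inner x (D Y x v) (Z x) + g.inner x (Y x) (D Z x v)

theorem isLeviCivita_leviCivita (g : Metric E M) : IsLeviCivita g (leviCivita g) where
  torsion_free X Y x hX hY := by
    refine inner_ext g x fun w ↦ ?_
    have hw := diffAt_extend w
    have h1 := inner_koszulNabla g hX hY hw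
    have h2 := inner_koszulNabla g hY hX hw
    simp only [extend_apply_self] at h1 h2
    change g.inner x (koszulNabla g Y x (X x) - koszulNabla g X x (Y x)) w = _
    simp [h1, h2, koszul, mlieBracket_swap_apply (V := Y) (W := X), g.symm _ (Y _) (X _)]
    ring
  metric Y Z x hY hZ v := by
    have hv := diffAt_extend v
    have h1 := inner_koszulNabla g hv hY hZ
    have h2 := inner_koszulNabla g hv hZ hY
    simp only [extend_apply_self] at h1 h2
    change _ = g.inner x (koszulNabla g Y x v) (Z x) + g.inner x (Y x) (koszulNabla g Z x v)
    rw [g.symm x (Y x)]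
    simp [h1, h2, koszul, mlieBracket_swap_apply (V := Z) (W := Y), g.symm _ (Z _) (Y _)]
    ring

/-- The curvature `R(X, Y)Z = ∇_X ∇_Y Z - ∇_Y ∇_X Z - ∇_[X,Y] Z` of `g`, at `x`. -/
def curv (g : Metric E M) (X Y Z : VField E M) (x : M) : TangentSpace 𝓘(ℝ, E) x :=
  leviCivita g (fun y ↦ leviCivita g Z y (Y y)) x (X x)
    - leviCivita g (fun y ↦ leviCivita g Z y (X y)) x (Y x)
    - leviCivita g Z x (mlieBracket 𝓘(ℝ, E) X Y x)

/-- The trace `∑ i, T(e_i, e_i)` of a `(0,2)`-tensor with respect to `g`. -/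
def traceAt (g : Metric E M) (x : M)
    (T : TangentSpace 𝓘(ℝ, E) x → TangentSpace 𝓘(ℝ, E) x → ℝ) : ℝ :=
  ∑ i, T (frame g x i) (frame g x i)

/-- The squared Hilbert-Schmidt norm `∑ i j, T(e_i, e_j)²` of a `(0,2)`-tensor with respect
to `g`. -/
def normSqAt (g : Metric E M) (x : M)
    (T : TangentSpace 𝓘(ℝ, E) x → TangentSpace 𝓘(ℝ, E) x → ℝ) : ℝ :=
  ∑ i, ∑ j, T (frame g x i) (frame g x j) ^ 2

/-- The Ricci tensor `Ric(v, w) = ∑ i, g(R(e_i, v)w, e_i)`. The curvature is evaluated at tangent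
vectors through vector fields extending them which are smooth near `x`. -/
def ric (g : Metric E M) (x : M) (v w : TangentSpace 𝓘(ℝ, E) x) : ℝ :=
  traceAt g x fun u u' ↦ g.inner x (curv g (extend E u) (extend E v) (extend E w) x) u'

/-- The scalar curvature. -/
def scal (g : Metric E M) (x : M) : ℝ := traceAt g x (ric g x)

/-- The gradient of `f`. -/
def grad (g : Metric E M) (f : M → ℝ) : VField E M :=
  fun x ↦ sharp g x (d% f x)

/-- The Hessian `Hess f (v, w) = g(∇_v grad f, w)`. -/
def hess (g : Metric E M) (f : M → ℝ) (x : M) (v w : TangentSpace 𝓘(ℝ, E) x) : ℝ :=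
  g.inner x (leviCivita g (grad g f) x v) w

/-- The Laplacian `Δ f = div (grad f)`, i.e. the trace of the Hessian. -/
def laplacian (g : Metric E M) (f : M → ℝ) (x : M) : ℝ := traceAt g x (hess g f x)

/-- The derivative `X(f)` of a function along a vector field. -/
def dirDeriv (X : VField E M) (f : M → ℝ) : M → ℝ := fun x ↦ d% f x (X x)

/-- The Lie derivative `(L_V g)(X, Y) = V(g(X, Y)) - g([V, X], Y) - g(X, [V, Y])`. -/
def lieMetric (g : Metric E M) (V X Y : VField E M) (x : M) : ℝ :=
  dirDeriv V (fun y ↦ g.inner y (X y) (Y y)) x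
    - g.inner x (mlieBracket 𝓘(ℝ, E) V X x) (Y x)
    - g.inner x (X x) (mlieBracket 𝓘(ℝ, E) V Y x)

/-- `(V, lam)` defines an almost Ricci soliton on `(M, g)`: `V` is a smooth vector field, `lam` is a
smooth function, and `1/2 L_V g + Ric = lam g`. -/
structure IsAlmostRicciSoliton (g : Metric E M) (V : VField E M) (lam : M → ℝ) : Prop where
  smooth_field : IsSmooth V
  smooth_lam : ContMDiff 𝓘(ℝ, E) 𝓘(ℝ, ℝ) ∞ lam
  equation : ∀ X Y : VField E M, IsSmooth X → IsSmooth Y → ∀ x : M,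
    1 / 2 * lieMetric g V X Y x + ric g x (X x) (Y x) = lam x * g.inner x (X x) (Y x)

end Riemannian

section Contact

/-- Almost contact metric structures `(φ, ξ, η, g)` on `M`. -/
structure AlmostContactMetric (E : Type*) [NormedAddCommGroup E] [NormedSpace ℝ E]
    [FiniteDimensional ℝ E] (M : Type*) [TopologicalSpace M] [ChartedSpace E M]
    [IsManifold 𝓘(ℝ, E) ∞ M] where
  /-- the `(1,1)`-tensor field -/
  φ : Π x : M, TangentSpace 𝓘(ℝ, E) x →L[ℝ] TangentSpace 𝓘(ℝ, E) x
  /-- the Reeb vector field -/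
  ξ : VField E M
  /-- the `1`-form -/
  η : Π x : M, TangentSpace 𝓘(ℝ, E) x →L[ℝ] ℝ
  /-- the Riemannian metric -/
  g : Metric E M
  smooth_φ : ContMDiff 𝓘(ℝ, E) (𝓘(ℝ, E).prod 𝓘(ℝ, E →L[ℝ] E)) ∞
    (fun x ↦ TotalSpace.mk' (E →L[ℝ] E)
      (E := fun x : M ↦ TangentSpace 𝓘(ℝ, E) x →L[ℝ] TangentSpace 𝓘(ℝ, E) x) x (φ x))
  smooth_ξ : IsSmooth ξ
  smooth_η : ContMDiff 𝓘(ℝ, E) (𝓘(ℝ, E).prod 𝓘(ℝ, E →L[ℝ] ℝ)) ∞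
    (fun x ↦ TotalSpace.mk' (E →L[ℝ] ℝ)
      (E := fun x : M ↦ TangentSpace 𝓘(ℝ, E) x →L[ℝ] Bundle.Trivial M ℝ x) x (η x))
  φ_sq : ∀ x v, φ x (φ x v) = -v + η x v • ξ x
  η_ξ : ∀ x, η x (ξ x) = 1
  η_eq : ∀ x v, η x v = g.inner x (ξ x) v
  inner_φ : ∀ x v w, g.inner x (φ x v) (φ x w) = g.inner x v w - η x v * η x w

variable {E : Type*} [NormedAddCommGroup E] [NormedSpace ℝ E] [FiniteDimensional ℝ E]
  {M : Type*} [TopologicalSpace M] [ChartedSpace E M] [IsManifold 𝓘(ℝ, E) ∞ M]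

namespace AlmostContactMetric

/-- The structure is Kenmotsu: `(∇_X φ)Y = g(φ X, Y) ξ - η(Y) φ X` for the Levi-Civita connection
of `g`, where `(∇_X φ)Y = ∇_X (φ Y) - φ (∇_X Y)`. -/
def IsKenmotsu (S : AlmostContactMetric E M) : Prop :=
  ∀ X Y : VField E M, IsSmooth X → IsSmooth Y → ∀ x : M,
    leviCivita S.g (fun y ↦ S.φ y (Y y)) x (X x) - S.φ x (leviCivita S.g Y x (X x)) =
      S.g.inner x (S.φ x (X x)) (Y x) • S.ξ x - S.η x (Y x) • S.φ x (X x)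

theorem sq_η_le (S : AlmostContactMetric E M) (x : M) (v : TangentSpace 𝓘(ℝ, E) x) :
    S.η x v ^ 2 ≤ S.g.inner x v v := by
  have h := S.inner_φ x v v
  have h2 : 0 ≤ S.g.inner x (S.φ x v) (S.φ x v) := by
    rcases eq_or_ne (S.φ x v) 0 with h0 | h0
    · simp [h0]
    · exact (S.g.pos x _ h0).le
  nlinarith

theorem η_φ (S : AlmostContactMetric E M) (x : M) (v : TangentSpace 𝓘(ℝ, E) x) :
    S.η x (S.φ x v) = 0 := by
  have h1 : S.φ x (S.ξ x) = 0 := by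
    by_contra h
    have h2 := S.g.pos x _ h
    rw [S.inner_φ, ← S.η_eq, S.η_ξ] at h2
    norm_num at h2
  have h3 := S.φ_sq x (S.φ x v)
  rw [S.φ_sq x v, map_add, map_neg, map_smul, h1, smul_zero, add_right_inj] at h3
  have h4 := congrArg (S.η x) h3.symm
  rwa [map_smul, S.η_ξ, smul_eq_mul, mul_one, map_zero] at h4

theorem smooth_η_tensor_η (S : AlmostContactMetric E M) :
    ContMDiff 𝓘(ℝ, E) (𝓘(ℝ, E).prod 𝓘(ℝ, E →L[ℝ] E →L[ℝ] ℝ)) ∞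
      (fun x ↦ TotalSpace.mk' (E →L[ℝ] E →L[ℝ] ℝ)
        (E := fun x : M ↦ TangentSpace 𝓘(ℝ, E) x →L[ℝ] TangentSpace 𝓘(ℝ, E) x →L[ℝ]
          Bundle.Trivial M ℝ x) x ((S.η x).smulRight (S.η x))) := by
  intro x₀
  have h := (contMDiffAt_hom_bundle _).1 (S.smooth_η x₀)
  refine (contMDiffAt_hom_bundle _).2 ⟨contMDiffAt_id, ?_⟩
  have h2 := (contDiff_smulRight_self E).comp_contMDiffAt h.2
  refine h2.congr_of_eventuallyEq ?_
  have A : ∀ᶠ y in 𝓝 x₀, y ∈ (trivializationAt E (TangentSpace 𝓘(ℝ, E)) x₀).baseSet :=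
    (trivializationAt E (TangentSpace 𝓘(ℝ, E)) x₀).open_baseSet.mem_nhds
      (FiberBundle.mem_baseSet_trivializationAt' x₀)
  filter_upwards [A] with y hy
  ext v w
  rw [inCoordinates_apply_eq₂ hy hy (by simp)]
  simp [ContinuousLinearMap.inCoordinates]
  rw [Trivialization.symmL_apply _ hy, Trivialization.symmL_apply _ hy]

/-- The metric `a g + a (a - 1) η ⊗ η`. -/
def deformMetric (S : AlmostContactMetric E M) (a : ℝ) (ha : 0 < a) : Metric E M where
  inner x := a • S.g.inner x + (a * (a - 1)) • (S.η x).smulRight (S.η x)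
  symm x v w := by
    simp only [add_apply, smul_apply, ContinuousLinearMap.smulRight_apply, smul_eq_mul,
      S.g.symm x v w]
    ring
  pos x v hv := by
    have h1 := S.g.pos x v hv
    have h2 := S.sq_η_le x v
    simp only [add_apply, smul_apply, ContinuousLinearMap.smulRight_apply, smul_eq_mul]
    rcases lt_or_ge a 1 with h | h
    · nlinarith [mul_nonneg (mul_nonneg ha.le (sub_nonneg.2 h.le)) (sub_nonneg.2 h2),
        mul_pos (mul_pos ha ha) h1]
    · nlinarith [mul_nonneg (mul_nonneg ha.le (sub_nonneg.2 h)) (sq_nonneg (S.η x v)),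
        mul_pos ha h1]
  isVonNBounded x := by
    have hr : 0 < 1 + 1 / a := by positivity
    refine (Bornology.IsVonNBounded.image (S.g.isVonNBounded x)
      ((1 + 1 / a) • ContinuousLinearMap.id ℝ (TangentSpace 𝓘(ℝ, E) x))).subset fun v hv ↦ ?_
    refine ⟨(1 + 1 / a)⁻¹ • v, ?_, smul_inv_smul₀ hr.ne' v⟩
    have h1 := S.sq_η_le x v
    have h2 : 0 ≤ S.g.inner x v v := (sq_nonneg _).trans h1
    simp only [mem_ofPred_eq, add_apply, smul_apply, ContinuousLinearMap.smulRight_apply,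
      smul_eq_mul, map_smul] at hv ⊢
    have h3 : (1 + 1 / a)⁻¹ = a / (a + 1) := by field_simp
    rw [h3]
    have h4 : a / (a + 1) * (a / (a + 1) * S.g.inner x v v) =
      a ^ 2 * S.g.inner x v v / (a + 1) ^ 2 := by field_simp
    rw [h4, div_lt_one (by positivity)]
    nlinarith [mul_nonneg ha.le h2, mul_nonneg ha.le (sub_nonneg.2 h1),
      mul_nonneg (sq_nonneg a) (sq_nonneg (S.η x v)), mul_nonneg ha.le (sq_nonneg (S.η x v)),
      mul_nonneg (sq_nonneg a) (sub_nonneg.2 h1), mul_nonneg (pow_nonneg ha.le 3) (sub_nonneg.2 h1)]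
  contMDiff := by
    have h := (S.g.contMDiff.const_smul_section (a := a)).add_section
      (S.smooth_η_tensor_η.const_smul_section (a := a * (a - 1)))
    exact h

/-- The `D`-homothetic deformation `(φ, a⁻¹ ξ, a η, a g + a (a - 1) η ⊗ η)`. -/
def deform (S : AlmostContactMetric E M) (a : ℝ) (ha : 0 < a) : AlmostContactMetric E M where
  φ := S.φ
  ξ := fun x ↦ (1 / a) • S.ξ x
  η := fun x ↦ a • S.η x
  g := S.deformMetric a ha
  smooth_φ := S.smooth_φ
  smooth_ξ := S.smooth_ξ.const_smul_section
  smooth_η := S.smooth_η.const_smul_section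
  φ_sq x v := by
    rw [S.φ_sq, smul_apply, smul_smul, smul_eq_mul]
    congr 2
    field_simp
  η_ξ x := by simp [S.η_ξ, ha.ne']
  η_eq x v := by
    simp [deformMetric, S.η_ξ, ← S.η_eq]
    field_simp
    ring
  inner_φ x v w := by
    simp [deformMetric, S.inner_φ, S.η_φ]
    ring

end AlmostContactMetric

end Contact

end Kenmotsu

end

open Kenmotsu

/-
The Levi-Civita connections of `ḡ` and `g` differ by `(a - 1)/a • T ⊗ ξ`, where `T = g - η ⊗ η`.
Hence `Ric` and `Hess f` change by multiples of `T`, and the soliton equation of `ḡ`, evaluated once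
at `(ξ, ξ)` to eliminate the soliton function, becomes `Ric = -Hess f + u g + b η ⊗ η` with
`b = (a - 1)/a (ξ(ξ(f)) - ξ(f))`. Comparing the norms of the trace-free parts expresses
`(2n + 1)|Ric|² - scal²` through `f`, and the inequality is
`0 ≤ (scal + 2n(2n + 1)(a - 1)/a)²`.
-/

namespace Kenmotsu

section Bracket

variable {E : Type*} [NormedAddCommGroup E] [NormedSpace ℝ E]
  {M : Type*} [TopologicalSpace M] [ChartedSpace E M]

theorem mvfderiv_congr {h h' : M → ℝ} {x : M} (hh : h =ᶠ[𝓝 x] h') : d% h x = d% h' x := by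
  ext v
  simp only [mvfderiv, hh.mfderiv_eq]
  rfl

theorem mvfderiv_const_mul (c : ℝ) {h : M → ℝ} {x : M}
    (hh : MDifferentiableAt 𝓘(ℝ, E) 𝓘(ℝ, ℝ) h x) : d% (fun y ↦ c * h y) x = c • d% h x := by
  rw [mvfderiv_fun_mul mdifferentiableAt_const hh, mvfderiv_const, smul_zero, add_zero]

variable [IsManifold 𝓘(ℝ, E) ∞ M]

/-- The vector field `X` is of class `C²` at `x`. -/
abbrev C2At (X : VField E M) (x : M) : Prop :=
  ContMDiffAt 𝓘(ℝ, E) 𝓘(ℝ, E).tangent 2 (fun y ↦ (X y : TangentBundle 𝓘(ℝ, E) M)) x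

theorem C2At.diffAt {X : VField E M} {x : M} (hX : C2At X x) : DiffAt X x :=
  hX.mdifferentiableAt two_ne_zero

theorem C2At.eventually {X : VField E M} {x : M} (hX : C2At X x) : ∀ᶠ y in 𝓝 x, C2At X y :=
  (contMDiffAt_iff_contMDiffAt_nhds (by decide)).1 hX

theorem IsSmooth.c2At {X : VField E M} (hX : IsSmooth X) (x : M) : C2At X x :=
  (hX x).of_le ENat.LEInfty.out

theorem c2At_extend {x : M} (v : TangentSpace 𝓘(ℝ, E) x) : C2At (extend E v) x :=
  contMDiffAt_extend 𝓘(ℝ, E) E v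

theorem mdifferentiableAt_dirDeriv {X : VField E M} {h : M → ℝ} {x : M} (hX : C2At X x)
    (hh : ContMDiffAt 𝓘(ℝ, E) 𝓘(ℝ, ℝ) 2 h x) :
    MDifferentiableAt 𝓘(ℝ, E) 𝓘(ℝ, ℝ) (dirDeriv X h) x := by
  have hdh := ContMDiffAt.clm_apply_of_inCoordinates (n := 1) (b₁ := id) (b₂ := h) (v := X)
    (E₁ := fun x : M ↦ TangentSpace 𝓘(ℝ, E) x) (F₁ := E) (F₂ := ℝ)
    (E₂ := fun x : ℝ ↦ TangentSpace 𝓘(ℝ, ℝ) x) (ϕ := fun m ↦ mfderiv 𝓘(ℝ, E) 𝓘(ℝ, ℝ) h m)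
    (m₀ := x) (hh.mfderiv_const (m := 1) (by norm_num)) (hX.of_le one_le_two)
    (hh.of_le one_le_two)
  convert! (contMDiffAt_totalSpace.1 hdh).2.mdifferentiableAt one_ne_zero using 1
  ext y
  simp only [dirDeriv, mvfderiv, ContinuousLinearMap.comp_apply,
    ContinuousLinearEquiv.coe_coe, id_eq, trivializationAt_model_space_apply]
  rfl

variable [CompleteSpace E]

theorem diffAt_mlieBracket {X Y : VField E M} {x : M} (hX : C2At X x) (hY : C2At Y x) :
    DiffAt (mlieBracket 𝓘(ℝ, E) X Y) x := by
  have : IsManifold 𝓘(ℝ, E) (((2 : ℕ∞) : ℕ∞ω) + 1) M := inferInstanceAs (IsManifold _ 3 M)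
  have : IsManifold 𝓘(ℝ, E) (minSmoothness ℝ 2) M := by
    rw [minSmoothness_of_isRCLikeNormedField]; infer_instance
  have hXY := ContMDiffAt.mlieBracket_vectorField (m := 1) (n := 2) hX hY
    (by rw [minSmoothness_of_isRCLikeNormedField]; norm_num)
  exact hXY.mdifferentiableAt one_ne_zero

theorem mlieBracket_mlieBracket_smul {X Y Z : VField E M} {h : M → ℝ} {x : M}
    (hY : C2At Y x) (hZ : C2At Z x) (hh : ContMDiffAt 𝓘(ℝ, E) 𝓘(ℝ, ℝ) 2 h x) :
    mlieBracket 𝓘(ℝ, E) X (mlieBracket 𝓘(ℝ, E) Y (h • Z)) x =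
      dirDeriv X (dirDeriv Y h) x • Z x + dirDeriv Y h x • mlieBracket 𝓘(ℝ, E) X Z x
        + dirDeriv X h x • mlieBracket 𝓘(ℝ, E) Y Z x
        + h x • mlieBracket 𝓘(ℝ, E) X (mlieBracket 𝓘(ℝ, E) Y Z) x := by
  have hYZ : mlieBracket 𝓘(ℝ, E) Y (h • Z) =ᶠ[𝓝 x]
      dirDeriv Y h • Z + h • mlieBracket 𝓘(ℝ, E) Y Z := by
    filter_upwards [hZ.eventually, (contMDiffAt_iff_contMDiffAt_nhds (by decide)).1 hh]
      with y hZy hhy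
    exact mlieBracket_smul_right (hhy.mdifferentiableAt two_ne_zero) hZy.diffAt
  have dh := hh.mdifferentiableAt two_ne_zero
  have dYh := mdifferentiableAt_dirDeriv hY hh
  have dYZ := diffAt_mlieBracket hY hZ
  rw [Filter.EventuallyEq.mlieBracket_vectorField_eq (.refl _ X) hYZ,
    mlieBracket_add_right (dYh.smul_section hZ.diffAt) (dh.smul_section dYZ),
    mlieBracket_smul_right dYh hZ.diffAt, mlieBracket_smul_right dh dYZ]
  simp only [dirDeriv]
  abel

/-- Comparing the Jacobi identity for `X, Y, Z` with that for `X, Y, h Z` leaves the asserted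
identity multiplied by `Z`. -/
theorem dirDeriv_comm_smul {X Y Z : VField E M} {h : M → ℝ} {x : M} (hX : C2At X x)
    (hY : C2At Y x) (hZ : C2At Z x) (hh : ContMDiffAt 𝓘(ℝ, E) 𝓘(ℝ, ℝ) 2 h x) :
    (dirDeriv X (dirDeriv Y h) x - dirDeriv Y (dirDeriv X h) x) • Z x =
      d% h x (mlieBracket 𝓘(ℝ, E) X Y x) • Z x := by
  have : IsManifold 𝓘(ℝ, E) (minSmoothness ℝ 3) M := by
    rw [minSmoothness_of_isRCLikeNormedField]; infer_instance
  have jacobi {W : VField E M} (hW : C2At W x) := leibniz_identity_mlieBracket_apply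
    (I := 𝓘(ℝ, E)) (U := X) (V := Y) (W := W) (x := x) (by simpa using hX) (by simpa using hY)
    (by simpa using hW)
  have jacobi_hZ := jacobi (W := h • Z) (hh.smul_section hZ)
  rw [mlieBracket_mlieBracket_smul hY hZ hh, mlieBracket_mlieBracket_smul hX hZ hh,
    mlieBracket_smul_right (hh.mdifferentiableAt two_ne_zero) hZ.diffAt, jacobi hZ,
    ← sub_eq_zero] at jacobi_hZ
  rw [← sub_eq_zero, ← jacobi_hZ]
  module

theorem dirDeriv_comm {X Y : VField E M} {h : M → ℝ} {x : M} (hX : C2At X x)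
    (hY : C2At Y x) (hh : ContMDiffAt 𝓘(ℝ, E) 𝓘(ℝ, ℝ) 2 h x) :
    dirDeriv X (dirDeriv Y h) x - dirDeriv Y (dirDeriv X h) x =
      d% h x (mlieBracket 𝓘(ℝ, E) X Y x) := by
  rcases subsingleton_or_nontrivial (TangentSpace 𝓘(ℝ, E) x) with _ | _
  · have dh_eq_zero (v : TangentSpace 𝓘(ℝ, E) x) (k : M → ℝ) : d% k x v = 0 := by
      rw [Subsingleton.elim v 0, map_zero]
    simp only [dirDeriv, dh_eq_zero, sub_zero]
  · obtain ⟨v, hv⟩ := exists_ne (0 : TangentSpace 𝓘(ℝ, E) x)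
    have h_smul := dirDeriv_comm_smul hX hY (c2At_extend v) hh
    rw [extend_apply_self] at h_smul
    exact smul_left_injective ℝ hv h_smul

end Bracket

section Gram

variable {E : Type*} [NormedAddCommGroup E] [NormedSpace ℝ E]
  {M : Type*} [TopologicalSpace M] [ChartedSpace E M]

theorem mdifferentiableAt_of_clm_apply {F : Type*} [NormedAddCommGroup F] [NormedSpace ℝ F]
    [CompleteSpace F] {A : M → F →L[ℝ] F} {C β : M → F} {x : M}
    (hA : MDifferentiableAt 𝓘(ℝ, E) 𝓘(ℝ, F →L[ℝ] F) A x)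
    (hβ : MDifferentiableAt 𝓘(ℝ, E) 𝓘(ℝ, F) β x) (hAx : (A x).IsInvertible)
    (hC : ∀ᶠ y in 𝓝 x, A y (C y) = β y) : MDifferentiableAt 𝓘(ℝ, E) 𝓘(ℝ, F) C x := by
  have inverse_diff : DifferentiableAt ℝ ContinuousLinearMap.inverse (A x) :=
    hAx.contDiffAt_map_inverse.differentiableAt one_ne_zero
  have invertible_near : ∀ᶠ y in 𝓝 x, (A y).IsInvertible := by
    obtain ⟨e, he⟩ := hAx
    exact hA.continuousAt (he ▸ ContinuousLinearEquiv.nhds e)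
  refine ((inverse_diff.mdifferentiableAt.comp x hA).clm_apply hβ).congr_of_eventuallyEq ?_
  filter_upwards [invertible_near, hC] with y hAy hCy
  rw [Function.comp_apply, ← hCy, hAy.inverse_apply_self]

theorem mdifferentiableAt_pi {ι : Type*} [Fintype ι] {β : M → ι → ℝ} {x : M}
    (h : ∀ i, MDifferentiableAt 𝓘(ℝ, E) 𝓘(ℝ, ℝ) (β · i) x) :
    MDifferentiableAt 𝓘(ℝ, E) 𝓘(ℝ, ι → ℝ) β x :=
  ⟨continuousWithinAt_pi.2 fun i ↦ (h i).1, differentiableWithinAt_pi.2 fun i ↦ (h i).2⟩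

variable [FiniteDimensional ℝ E] [IsManifold 𝓘(ℝ, E) ∞ M] {ι : Type*} [Fintype ι] [DecidableEq ι]

/-- The Gram matrix of the fields `s i` at `y`, as an operator on coefficient vectors. It is written
as a sum of elementary matrices, so that it visibly depends differentiably on `y`. -/
noncomputable def gramMap (g : Metric E M) (s : ι → VField E M) (y : M) :
    (ι → ℝ) →L[ℝ] (ι → ℝ) :=
  ∑ i, ∑ j, g.inner y (s i y) (s j y) • (ContinuousLinearMap.proj i).smulRight (Pi.single j 1)

theorem gramMap_apply (g : Metric E M) (s : ι → VField E M) (y : M) (u : ι → ℝ) (j : ι) :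
    gramMap g s y u j = g.inner y (∑ i, u i • s i y) (s j y) := by
  simp [gramMap, Pi.single_apply, mul_comm]

theorem gramMap_injective (g : Metric E M) {s : ι → VField E M} {y : M}
    (hs : LinearIndependent ℝ (s · y)) : Function.Injective (gramMap g s y) := by
  refine (injective_iff_map_eq_zero _).2 fun u hu ↦ ?_
  have combination_eq_zero : ∑ i, u i • s i y = 0 := by
    by_contra hne
    refine (g.pos y _ hne).ne' ?_
    conv_lhs => rw [map_sum]
    refine Finset.sum_eq_zero fun j _ ↦ ?_
    rw [map_smul, ← gramMap_apply, hu, Pi.zero_apply, smul_zero]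
  exact funext (Fintype.linearIndependent_iff.1 hs u combination_eq_zero)

theorem gramMap_isInvertible (g : Metric E M) {s : ι → VField E M} {y : M}
    (hs : LinearIndependent ℝ (s · y)) : (gramMap g s y).IsInvertible :=
  ⟨(LinearEquiv.ofInjectiveEndo (gramMap g s y).toLinearMap
    (gramMap_injective g hs)).toContinuousLinearEquiv, rfl⟩

theorem mdifferentiableAt_gramMap (g : Metric E M) {s : ι → VField E M} {x : M}
    (hs : ∀ i, DiffAt (s i) x) :
    MDifferentiableAt 𝓘(ℝ, E) 𝓘(ℝ, (ι → ℝ) →L[ℝ] (ι → ℝ)) (gramMap g s) x := by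
  have sum_diff : MDifferentiableAt 𝓘(ℝ, E) 𝓘(ℝ, (ι → ℝ) →L[ℝ] (ι → ℝ))
      (∑ i, ∑ j, fun y ↦ g.inner y (s i y) (s j y) •
        (ContinuousLinearMap.proj (R := ℝ) (φ := fun _ : ι ↦ ℝ) i).smulRight
          (Pi.single (M := fun _ : ι ↦ ℝ) j (1 : ℝ))) x :=
    Finset.sum_induction _ (MDifferentiableAt _ _ · x) (fun _ _ ↦ .add) mdifferentiableAt_const
      fun i _ ↦ Finset.sum_induction _ (MDifferentiableAt _ _ · x) (fun _ _ ↦ .add)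
        mdifferentiableAt_const fun j _ ↦
          (mdifferentiableAt_inner g (hs i) (hs j)).smul mdifferentiableAt_const
  convert! sum_diff using 1
  ext1 y
  simp only [gramMap, Finset.sum_apply]

theorem diffAt_of_inner (g : Metric E M) {W : VField E M} {x : M}
    (h : ∀ Z : VField E M, C2At Z x →
      MDifferentiableAt 𝓘(ℝ, E) 𝓘(ℝ, ℝ) (fun y ↦ g.inner y (W y) (Z y)) x) : DiffAt W x := by
  let t := trivializationAt E (TangentSpace 𝓘(ℝ, E) : M → Type _) x
  have hx : x ∈ t.baseSet := FiberBundle.mem_baseSet_trivializationAt' x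
  let b := Module.finBasis ℝ E
  let s := t.localFrame b
  have hs (i) : C2At (s i) x := contMDiffAt_localFrame_of_mem 2 t b i hx
  have gram_coeff : ∀ᶠ y in 𝓝 x, gramMap g s y (fun i ↦ t.localFrameCoeff 𝓘(ℝ, E) b i y (W y)) =
      fun j ↦ g.inner y (W y) (s j y) := by
    filter_upwards [t.open_baseSet.mem_nhds hx] with y hy
    ext j
    rw [gramMap_apply, ← t.eq_sum_localFrameCoeff_smul (I := 𝓘(ℝ, E)) (b := b) (s := W) hy]
  have coeff_diff := mdifferentiableAt_of_clm_apply
    (mdifferentiableAt_gramMap g fun i ↦ (hs i).diffAt) (mdifferentiableAt_pi fun j ↦ h _ (hs j))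
    (gramMap_isInvertible g
      ((t.isLocalFrameOn_localFrame_baseSet 𝓘(ℝ, E) 2 b).linearIndependent hx))
    gram_coeff
  exact (mdifferentiableAt_iff_localFrameCoeff b hx).2 fun i ↦
    (ContinuousLinearMap.proj (R := ℝ) (φ := fun _ ↦ ℝ) i).differentiableAt.comp_mdifferentiableAt
      coeff_diff

end Gram

section Extend

variable {E : Type*} [NormedAddCommGroup E] [NormedSpace ℝ E]
  {M : Type*} [TopologicalSpace M] [ChartedSpace E M] [IsManifold 𝓘(ℝ, E) ∞ M]

theorem eventually_extend_eq {x : M} : ∀ᶠ y in 𝓝 x, ∀ v : TangentSpace 𝓘(ℝ, E) x,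
    extend E v y =
      (trivializationAt E (TangentSpace 𝓘(ℝ, E) : M → Type _) x).symmₗ ℝ y
        ((trivializationAt E (TangentSpace 𝓘(ℝ, E) : M → Type _) x).linearMapAt ℝ x v) := by
  have hx := FiberBundle.mem_baseSet_trivializationAt' (F := E)
    (E := (TangentSpace 𝓘(ℝ, E) : M → Type _)) x
  filter_upwards [(trivializationAt E (TangentSpace 𝓘(ℝ, E) : M → Type _)
    x).open_baseSet.mem_nhds hx] with y hy v
  rw [Trivialization.linearMapAt_apply, if_pos hx]
  exact (Trivialization.symmₗ_apply _ hy _).symm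

theorem extend_add {x : M} (u v : TangentSpace 𝓘(ℝ, E) x) :
    (extend E (u + v) : VField E M) =ᶠ[𝓝 x] extend E u + extend E v := by
  filter_upwards [eventually_extend_eq (E := E) (x := x)] with y hy
  simp only [Pi.add_apply, hy, map_add]
  rfl

theorem extend_smul {x : M} (c : ℝ) (v : TangentSpace 𝓘(ℝ, E) x) :
    (extend E (c • v) : VField E M) =ᶠ[𝓝 x] c • extend E v := by
  filter_upwards [eventually_extend_eq (E := E) (x := x)] with y hy
  simp only [Pi.smul_apply, hy, map_smul]
  rfl

theorem exists_isSmooth_eq [FiniteDimensional ℝ E] [T2Space M] (x : M)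
    (v : TangentSpace 𝓘(ℝ, E) x) : ∃ X : VField E M, IsSmooth X ∧ X x = v := by
  obtain ⟨s, hs, extend_smooth_on⟩ := exists_contMDiffOn_extend (k := ∞) 𝓘(ℝ, E) E v
  obtain ⟨ψ, hψ, -⟩ := (SmoothBumpFunction.nhds_basis_support (I := 𝓘(ℝ, E))
    (interior_mem_nhds.2 hs)).mem_iff.1 (interior_mem_nhds.2 hs)
  refine ⟨(ψ : M → ℝ) • extend E v, ?_, ?_⟩
  · exact ContMDiffOn.smul_section_of_tsupport ψ.contMDiff.contMDiffOn isOpen_interior hψ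
      (extend_smooth_on.mono interior_subset)
  · rw [Pi.smul_apply', ψ.eq_one, one_smul, extend_apply_self]

end Extend

section LeviCivita

variable {E : Type*} [NormedAddCommGroup E] [NormedSpace ℝ E] [FiniteDimensional ℝ E]
  {M : Type*} [TopologicalSpace M] [ChartedSpace E M] [IsManifold 𝓘(ℝ, E) ∞ M]

theorem contMDiffAt_inner (g : Metric E M) {X Y : VField E M} {x : M}
    (hX : C2At X x) (hY : C2At Y x) :
    ContMDiffAt 𝓘(ℝ, E) 𝓘(ℝ, ℝ) 2 (fun y ↦ g.inner y (X y) (Y y)) x := by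
  let _ : RiemannianBundle (fun x : M ↦ TangentSpace 𝓘(ℝ, E) x) := ⟨g.toRiemannianMetric⟩
  have : IsContMDiffRiemannianBundle 𝓘(ℝ, E) 2 E (fun x : M ↦ TangentSpace 𝓘(ℝ, E) x) :=
    ⟨⟨g.inner, g.contMDiff.of_le ENat.LEInfty.out, fun _ _ _ ↦ rfl⟩⟩
  exact ContMDiffAt.inner_bundle (F := E) (E := fun x : M ↦ TangentSpace 𝓘(ℝ, E) x) hX hY

theorem diffAt_leviCivita (g : Metric E M) {Y Z : VField E M} {x : M} (hY : C2At Y x)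
    (hZ : C2At Z x) : DiffAt (fun y ↦ leviCivita g Z y (Y y)) x := by
  refine diffAt_of_inner g fun W hW ↦ ?_
  have inner_nabla : (fun y ↦ g.inner y (leviCivita g Z y (Y y)) (W y)) =ᶠ[𝓝 x]
      fun y ↦ 1 / 2 * koszul g Y Z W y := by
    filter_upwards [hY.eventually, hZ.eventually, hW.eventually] with y hYy hZy hWy
    exact inner_koszulNabla g hYy.diffAt hZy.diffAt hWy.diffAt
  refine (MDifferentiableAt.mul (mdifferentiableAt_const (c := (1 / 2 : ℝ)))
    (((((?_ : MDifferentiableAt 𝓘(ℝ, E) 𝓘(ℝ, ℝ) _ x).add ?_).sub ?_).add ?_).sub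
      ?_ |>.sub ?_)).congr_of_eventuallyEq inner_nabla
  · exact mdifferentiableAt_dirDeriv hY (contMDiffAt_inner g hZ hW)
  · exact mdifferentiableAt_dirDeriv hZ (contMDiffAt_inner g hY hW)
  · exact mdifferentiableAt_dirDeriv hW (contMDiffAt_inner g hY hZ)
  · exact mdifferentiableAt_inner g (diffAt_mlieBracket hY hZ) hW.diffAt
  · exact mdifferentiableAt_inner g (diffAt_mlieBracket hY hW) hZ.diffAt
  · exact mdifferentiableAt_inner g (diffAt_mlieBracket hZ hW) hY.diffAt

theorem leviCivita_add (g : Metric E M) {Y Y' : VField E M} {x : M} (hY : DiffAt Y x)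
    (hY' : DiffAt Y' x) (v : TangentSpace 𝓘(ℝ, E) x) :
    leviCivita g (Y + Y') x v = leviCivita g Y x v + leviCivita g Y' x v := by
  rw [(leviCivita g).isCovariantDerivativeOnUniv.add hY hY', add_apply]

theorem leviCivita_smul (g : Metric E M) {Y : VField E M} {h : M → ℝ} {x : M} (hY : DiffAt Y x)
    (hh : MDifferentiableAt 𝓘(ℝ, E) 𝓘(ℝ, ℝ) h x) (v : TangentSpace 𝓘(ℝ, E) x) :
    leviCivita g (h • Y) x v = h x • leviCivita g Y x v + d% h x v • Y x := by
  rw [(leviCivita g).isCovariantDerivativeOnUniv.leibniz hY hh]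
  rfl

theorem leviCivita_const_smul (g : Metric E M) {Y : VField E M} (c : ℝ) {x : M} (hY : DiffAt Y x)
    (v : TangentSpace 𝓘(ℝ, E) x) : leviCivita g (c • Y) x v = c • leviCivita g Y x v := by
  rw [(leviCivita g).isCovariantDerivativeOnUniv.smul_const c hY, smul_apply]

theorem leviCivita_congr (g : Metric E M) {Y Y' : VField E M} {x : M} (hY : DiffAt Y x)
    (h : Y =ᶠ[𝓝 x] Y') : leviCivita g Y x = leviCivita g Y' x :=
  (leviCivita g).isCovariantDerivativeOnUniv.congr_of_eventuallyEq hY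
    (hY.congr_of_eventuallyEq (h.symm.mono fun y hy ↦ by simp only [hy])) Filter.univ_mem h

theorem eq_leviCivita (g : Metric E M) {x : M}
    {D : VField E M → TangentSpace 𝓘(ℝ, E) x → TangentSpace 𝓘(ℝ, E) x}
    (torsion_free : ∀ X Y, DiffAt X x → DiffAt Y x →
      D Y (X x) - D X (Y x) = mlieBracket 𝓘(ℝ, E) X Y x)
    (metric : ∀ Y Z, DiffAt Y x → DiffAt Z x → ∀ v,
      d% (fun y ↦ g.inner y (Y y) (Z y)) x v = g.inner x (D Y v) (Z x) + g.inner x (Y x) (D Z v))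
    {Y : VField E M} (hY : DiffAt Y x) (v : TangentSpace 𝓘(ℝ, E) x) :
    leviCivita g Y x v = D Y v := by
  refine inner_ext g x fun w ↦ ?_
  have hv := diffAt_extend v
  have hw := diffAt_extend w
  have koszul_formula := inner_koszulNabla g hv hY hw
  rw [koszul, metric _ _ hY hw, metric _ _ hv hw, metric _ _ hv hY, ← torsion_free _ _ hv hY,
    ← torsion_free _ _ hv hw, ← torsion_free _ _ hY hw] at koszul_formula
  simp only [extend_apply_self, map_sub, sub_apply] at koszul_formula
  refine koszul_formula.trans ?_
  rw [g.symm x (Y x) (D (extend E w) v), g.symm x v (D (extend E w) (Y x)), g.symm x v (D Y w)]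
  ring

end LeviCivita

section Curvature

variable {E : Type*} [NormedAddCommGroup E] [NormedSpace ℝ E] [FiniteDimensional ℝ E]
  {M : Type*} [TopologicalSpace M] [ChartedSpace E M] [IsManifold 𝓘(ℝ, E) ∞ M]

theorem curv_congr_left (g : Metric E M) {X X' Y Z : VField E M} {x : M} (hX : C2At X x)
    (hZ : C2At Z x) (h : X =ᶠ[𝓝 x] X') : curv g X Y Z x = curv g X' Y Z x := by
  have nabla_eq : (fun y ↦ leviCivita g Z y (X y)) =ᶠ[𝓝 x] fun y ↦ leviCivita g Z y (X' y) :=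
    h.mono fun y hy ↦ congrArg (leviCivita g Z y) hy
  rw [curv, curv, leviCivita_congr g (diffAt_leviCivita g hX hZ) nabla_eq, h.self_of_nhds,
    h.mlieBracket_vectorField_eq (.refl _ Y)]

theorem curv_add_left (g : Metric E M) {X X' Y Z : VField E M} {x : M} (hX : C2At X x)
    (hX' : C2At X' x) (hZ : C2At Z x) :
    curv g (X + X') Y Z x = curv g X Y Z x + curv g X' Y Z x := by
  have nabla_add : (fun y ↦ leviCivita g Z y ((X + X') y)) =
      (fun y ↦ leviCivita g Z y (X y)) + fun y ↦ leviCivita g Z y (X' y) :=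
    funext fun y ↦ map_add _ _ _
  rw [curv, nabla_add, leviCivita_add g (diffAt_leviCivita g hX hZ) (diffAt_leviCivita g hX' hZ),
    mlieBracket_add_left hX.diffAt hX'.diffAt, Pi.add_apply, map_add, map_add, curv, curv]
  abel

theorem curv_smul_left (g : Metric E M) (c : ℝ) {X Y Z : VField E M} {x : M} (hX : C2At X x)
    (hZ : C2At Z x) : curv g (c • X) Y Z x = c • curv g X Y Z x := by
  have nabla_smul : (fun y ↦ leviCivita g Z y ((c • X) y)) =
      c • fun y ↦ leviCivita g Z y (X y) :=
    funext fun y ↦ map_smul _ _ _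
  rw [curv, nabla_smul, leviCivita_const_smul g c (diffAt_leviCivita g hX hZ),
    mlieBracket_const_smul_left hX.diffAt, Pi.smul_apply, map_smul, map_smul, curv, smul_sub,
    smul_sub]

theorem dirDeriv_dirDeriv_inner (g : Metric E M) {X Y Z W : VField E M} {x : M}
    (hY : C2At Y x) (hZ : C2At Z x) (hW : C2At W x) :
    dirDeriv X (dirDeriv Y fun y ↦ g.inner y (Z y) (W y)) x =
      g.inner x (leviCivita g (fun y ↦ leviCivita g Z y (Y y)) x (X x)) (W x)
        + g.inner x (leviCivita g Z x (Y x)) (leviCivita g W x (X x))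
        + (g.inner x (leviCivita g Z x (X x)) (leviCivita g W x (Y x))
        + g.inner x (Z x) (leviCivita g (fun y ↦ leviCivita g W y (Y y)) x (X x))) := by
  have metric := (isLeviCivita_leviCivita g).metric
  have dirDeriv_inner : (dirDeriv Y fun y ↦ g.inner y (Z y) (W y)) =ᶠ[𝓝 x]
      fun y ↦ g.inner y (leviCivita g Z y (Y y)) (W y)
        + g.inner y (Z y) (leviCivita g W y (Y y)) := by
    filter_upwards [hZ.eventually, hW.eventually] with y hZy hWy
    exact metric Z W y hZy.diffAt hWy.diffAt (Y y)
  have dZ := diffAt_leviCivita g hY hZ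
  have dW := diffAt_leviCivita g hY hW
  rw [dirDeriv, mvfderiv_congr dirDeriv_inner,
    mvfderiv_fun_add (mdifferentiableAt_inner g dZ hW.diffAt)
      (mdifferentiableAt_inner g hZ.diffAt dW),
    add_apply, metric _ _ x dZ hW.diffAt, metric _ _ x hZ.diffAt dW]

theorem inner_curv_skew (g : Metric E M) {X Y Z W : VField E M} {x : M} (hX : C2At X x)
    (hY : C2At Y x) (hZ : C2At Z x) (hW : C2At W x) :
    g.inner x (curv g X Y Z x) (W x) = - g.inner x (Z x) (curv g X Y W x) := by
  have h := dirDeriv_comm hX hY (contMDiffAt_inner g hZ hW)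
  rw [dirDeriv_dirDeriv_inner g hY hZ hW, dirDeriv_dirDeriv_inner g hX hZ hW,
    (isLeviCivita_leviCivita g).metric _ _ x hZ.diffAt hW.diffAt] at h
  simp only [curv, map_sub, sub_apply]
  linarith

/-- Skew-symmetry moves the third argument of `R` to a place where it enters algebraically. -/
theorem curv_congr_right (g : Metric E M) {X Y Z Z' : VField E M} {x : M} (hX : C2At X x)
    (hY : C2At Y x) (hZ : C2At Z x) (hZ' : C2At Z' x) (h : Z x = Z' x) :
    curv g X Y Z x = curv g X Y Z' x := by
  refine inner_ext g x fun w ↦ ?_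
  rw [← extend_apply_self (F := E) w, inner_curv_skew g hX hY hZ (c2At_extend w),
    inner_curv_skew g hX hY hZ' (c2At_extend w), h]

/-- The endomorphism `u ↦ R(u, v)w` of the tangent space at `x`, whose trace is `Ric(v, w)`. -/
noncomputable def curvEnd (g : Metric E M) (x : M) (v w : TangentSpace 𝓘(ℝ, E) x) :
    TangentSpace 𝓘(ℝ, E) x →ₗ[ℝ] TangentSpace 𝓘(ℝ, E) x where
  toFun u := curv g (extend E u) (extend E v) (extend E w) x
  map_add' u u' := by
    rw [curv_congr_left g (c2At_extend _) (c2At_extend w) (extend_add u u'),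
      curv_add_left g (c2At_extend u) (c2At_extend u') (c2At_extend w)]
  map_smul' c u := by
    rw [curv_congr_left g (c2At_extend _) (c2At_extend w) (extend_smul c u),
      curv_smul_left g c (c2At_extend u) (c2At_extend w), RingHom.id_apply]

end Curvature

section Trace

variable {E : Type*} [NormedAddCommGroup E] [NormedSpace ℝ E] [FiniteDimensional ℝ E]
  {M : Type*} [TopologicalSpace M] [ChartedSpace E M] [IsManifold 𝓘(ℝ, E) ∞ M]

theorem frame_repr (g : Metric E M) (x : M) (v : TangentSpace 𝓘(ℝ, E) x)
    (i : Fin (finrank ℝ E)) : (frame g x).repr v i = g.inner x v (frame g x i) := by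
  conv_rhs => rw [← (frame g x).sum_repr v]
  simp [-Basis.sum_repr, inner_frame]

theorem sum_inner_frame_smul (g : Metric E M) (x : M) (v : TangentSpace 𝓘(ℝ, E) x) :
    ∑ i, g.inner x v (frame g x i) • frame g x i = v := by
  simp only [← frame_repr, (frame g x).sum_repr v]

theorem traceAt_eq_trace (g : Metric E M) (x : M)
    (L : TangentSpace 𝓘(ℝ, E) x →ₗ[ℝ] TangentSpace 𝓘(ℝ, E) x) :
    traceAt g x (fun u u' ↦ g.inner x (L u) u') = LinearMap.trace ℝ _ L := by
  rw [LinearMap.trace_eq_matrix_trace ℝ (frame g x), traceAt, Matrix.trace]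
  simp only [Matrix.diag_apply, LinearMap.toMatrix_apply, frame_repr]

theorem ric_eq_trace (g : Metric E M) (x : M) (v w : TangentSpace 𝓘(ℝ, E) x) :
    ric g x v w = LinearMap.trace ℝ _ (curvEnd g x v w) :=
  traceAt_eq_trace g x (curvEnd g x v w)

end Trace

section Hessian

variable {E : Type*} [NormedAddCommGroup E] [NormedSpace ℝ E] [FiniteDimensional ℝ E]
  {M : Type*} [TopologicalSpace M] [ChartedSpace E M] [IsManifold 𝓘(ℝ, E) ∞ M]

theorem inner_grad (g : Metric E M) (f : M → ℝ) (x : M) (v : TangentSpace 𝓘(ℝ, E) x) :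
    g.inner x (grad g f x) v = d% f x v :=
  inner_sharp g x _ v

theorem diffAt_grad (g : Metric E M) {f : M → ℝ} {x : M}
    (hf : ContMDiffAt 𝓘(ℝ, E) 𝓘(ℝ, ℝ) 2 f x) : DiffAt (grad g f) x :=
  diffAt_of_inner g fun Z hZ ↦ by
    simp only [inner_grad]
    exact mdifferentiableAt_dirDeriv hZ hf

theorem hess_eq (g : Metric E M) {f : M → ℝ} {x : M} (hf : ContMDiffAt 𝓘(ℝ, E) 𝓘(ℝ, ℝ) 2 f x)
    {W : VField E M} (hW : DiffAt W x) (v : TangentSpace 𝓘(ℝ, E) x) :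
    hess g f x v (W x) = d% (dirDeriv W f) x v - d% f x (leviCivita g W x v) := by
  have metric_grad := (isLeviCivita_leviCivita g).metric _ _ x (diffAt_grad g hf) hW v
  simp only [inner_grad] at metric_grad
  rw [hess, eq_sub_iff_add_eq]
  exact metric_grad.symm

theorem hess_symm (g : Metric E M) {f : M → ℝ} {x : M} (hf : ContMDiffAt 𝓘(ℝ, E) 𝓘(ℝ, ℝ) 2 f x)
    (v w : TangentSpace 𝓘(ℝ, E) x) : hess g f x v w = hess g f x w v := by
  have hv := c2At_extend v
  have hw := c2At_extend w
  have hess_vw := hess_eq g hf hw.diffAt v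
  have hess_wv := hess_eq g hf hv.diffAt w
  have bracket := dirDeriv_comm hv hw hf
  rw [← (isLeviCivita_leviCivita g).torsion_free _ _ x hv.diffAt hw.diffAt, map_sub, dirDeriv,
    dirDeriv] at bracket
  simp only [extend_apply_self] at hess_vw hess_wv bracket
  rw [hess_vw, hess_wv]
  linarith

theorem lieMetric_grad (g : Metric E M) {f : M → ℝ} {x : M}
    (hf : ContMDiffAt 𝓘(ℝ, E) 𝓘(ℝ, ℝ) 2 f x) {X Y : VField E M} (hX : DiffAt X x)
    (hY : DiffAt Y x) : lieMetric g (grad g f) X Y x = 2 * hess g f x (X x) (Y x) := by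
  have LC := isLeviCivita_leviCivita g
  have dgrad := diffAt_grad g hf
  have symm := hess_symm g hf (X x) (Y x)
  rw [lieMetric, dirDeriv, LC.metric _ _ x hX hY, ← LC.torsion_free _ _ x dgrad hX,
    ← LC.torsion_free _ _ x dgrad hY, map_sub, map_sub, sub_apply,
    g.symm x (X x) (leviCivita g (grad g f) x (Y x))]
  simp only [hess] at symm ⊢
  linarith

end Hessian

section Contact

variable {E : Type*} [NormedAddCommGroup E] [NormedSpace ℝ E] [FiniteDimensional ℝ E]
  {M : Type*} [TopologicalSpace M] [ChartedSpace E M] [IsManifold 𝓘(ℝ, E) ∞ M]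

theorem inner_leviCivita_self_eq_zero (g : Metric E M) {X : VField E M} {x : M} (hX : DiffAt X x)
    {c : ℝ} (h : ∀ y, g.inner y (X y) (X y) = c) (v : TangentSpace 𝓘(ℝ, E) x) :
    g.inner x (X x) (leviCivita g X x v) = 0 := by
  have metric_X := (isLeviCivita_leviCivita g).metric _ _ x hX hX v
  rw [funext h, mvfderiv_const, zero_apply, g.symm x (leviCivita g X x v)] at metric_X
  linarith

namespace AlmostContactMetric

section Transverse

variable (S : AlmostContactMetric E M)

theorem φ_ξ (x : M) : S.φ x (S.ξ x) = 0 := by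
  by_contra h
  have norm_pos := S.g.pos x _ h
  rw [S.inner_φ, ← S.η_eq, S.η_ξ] at norm_pos
  norm_num at norm_pos

/-- The transverse part `g - η ⊗ η` of the metric, as a continuous bilinear form. -/
noncomputable def transverse (x : M) :
    TangentSpace 𝓘(ℝ, E) x →L[ℝ] TangentSpace 𝓘(ℝ, E) x →L[ℝ] ℝ :=
  S.g.inner x - (S.η x).smulRight (S.η x)

theorem transverse_apply (x : M) (v w : TangentSpace 𝓘(ℝ, E) x) :
    S.transverse x v w = S.g.inner x v w - S.η x v * S.η x w := by
  simp [transverse]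

theorem transverse_symm (x : M) (v w : TangentSpace 𝓘(ℝ, E) x) :
    S.transverse x v w = S.transverse x w v := by
  rw [transverse_apply, transverse_apply, S.g.symm x v w, mul_comm]

theorem transverse_ξ (x : M) (v : TangentSpace 𝓘(ℝ, E) x) : S.transverse x v (S.ξ x) = 0 := by
  rw [transverse_apply, S.g.symm, ← S.η_eq, S.η_ξ, mul_one, sub_self]

theorem deformMetric_inner (a : ℝ) (ha : 0 < a) (x : M) (v w : TangentSpace 𝓘(ℝ, E) x) :
    (S.deformMetric a ha).inner x v w =
      a ^ 2 * S.g.inner x v w - a * (a - 1) * S.transverse x v w := by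
  simp only [deformMetric, transverse, add_apply, sub_apply, smul_apply,
    ContinuousLinearMap.smulRight_apply, smul_eq_mul]
  ring

theorem mdifferentiableAt_η {Y : VField E M} {x : M} (hY : DiffAt Y x) :
    MDifferentiableAt 𝓘(ℝ, E) 𝓘(ℝ, ℝ) (fun y ↦ S.η y (Y y)) x := by
  simp only [S.η_eq]
  exact mdifferentiableAt_inner S.g (S.smooth_ξ.c2At x).diffAt hY

theorem mdifferentiableAt_transverse {Y Z : VField E M} {x : M} (hY : DiffAt Y x)
    (hZ : DiffAt Z x) :
    MDifferentiableAt 𝓘(ℝ, E) 𝓘(ℝ, ℝ) (fun y ↦ S.transverse y (Y y) (Z y)) x := by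
  simp only [transverse_apply]
  exact (mdifferentiableAt_inner S.g hY hZ).sub
    ((S.mdifferentiableAt_η hY).mul (S.mdifferentiableAt_η hZ))

end Transverse

namespace IsKenmotsu

variable [T2Space M] {S : AlmostContactMetric E M}

theorem nabla_ξ (hS : S.IsKenmotsu) (x : M) (v : TangentSpace 𝓘(ℝ, E) x) :
    leviCivita S.g S.ξ x v = v - S.η x v • S.ξ x := by
  have φ_nabla_ξ : S.φ x (leviCivita S.g S.ξ x v) = S.φ x v := by
    obtain ⟨X, hX, rfl⟩ := exists_isSmooth_eq x v
    have nabla_φ := hS X S.ξ hX S.smooth_ξ x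
    have φ_ξ_eq_zero : (fun y ↦ S.φ y (S.ξ y)) = (0 : VField E M) := funext S.φ_ξ
    rw [φ_ξ_eq_zero, CovariantDerivative.zero, S.g.symm, ← S.η_eq, S.η_φ, S.η_ξ] at nabla_φ
    simpa using nabla_φ
  have η_nabla_ξ : S.η x (leviCivita S.g S.ξ x v) = 0 := by
    rw [S.η_eq]
    exact inner_leviCivita_self_eq_zero S.g (S.smooth_ξ.c2At x).diffAt
      (fun y ↦ (S.η_eq y _).symm.trans (S.η_ξ y)) v
  have h := congrArg (S.φ x) φ_nabla_ξ
  rw [S.φ_sq, S.φ_sq, η_nabla_ξ, zero_smul, add_zero, neg_eq_iff_eq_neg] at h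
  rw [h]
  abel

theorem mvfderiv_η (hS : S.IsKenmotsu) {Y : VField E M} {x : M} (hY : DiffAt Y x)
    (v : TangentSpace 𝓘(ℝ, E) x) :
    d% (fun y ↦ S.η y (Y y)) x v = S.transverse x v (Y x) + S.η x (leviCivita S.g Y x v) := by
  have metric_ξ := (isLeviCivita_leviCivita S.g).metric _ _ x (S.smooth_ξ.c2At x).diffAt hY v
  simp only [← S.η_eq] at metric_ξ
  rw [metric_ξ, hS.nabla_ξ, transverse_apply, map_sub, map_smul, sub_apply, smul_apply,
    smul_eq_mul, ← S.η_eq]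

theorem mvfderiv_transverse (hS : S.IsKenmotsu) {Y Z : VField E M} {x : M}
    (hY : DiffAt Y x) (hZ : DiffAt Z x) (v : TangentSpace 𝓘(ℝ, E) x) :
    d% (fun y ↦ S.transverse y (Y y) (Z y)) x v =
      S.transverse x (leviCivita S.g Y x v) (Z x) + S.transverse x (Y x) (leviCivita S.g Z x v)
        - S.transverse x v (Y x) * S.η x (Z x) - S.η x (Y x) * S.transverse x v (Z x) := by
  have dηY := S.mdifferentiableAt_η hY
  have dηZ := S.mdifferentiableAt_η hZ
  have metric_g := (isLeviCivita_leviCivita S.g).metric _ _ x hY hZ v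
  have dηη : MDifferentiableAt 𝓘(ℝ, E) 𝓘(ℝ, ℝ) (fun y ↦ S.η y (Y y) * S.η y (Z y)) x :=
    dηY.mul dηZ
  simp only [S.transverse_apply]
  rw [mvfderiv_fun_sub (mdifferentiableAt_inner S.g hY hZ) dηη, sub_apply, metric_g,
    mvfderiv_fun_mul dηY dηZ, add_apply, smul_apply, smul_apply, hS.mvfderiv_η hY,
    hS.mvfderiv_η hZ]
  simp only [S.transverse_apply, smul_eq_mul]
  ring

end IsKenmotsu

end AlmostContactMetric

end Contact

section Deformation

variable {E : Type*} [NormedAddCommGroup E] [NormedSpace ℝ E] [FiniteDimensional ℝ E]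
  {M : Type*} [TopologicalSpace M] [ChartedSpace E M] [IsManifold 𝓘(ℝ, E) ∞ M]

namespace AlmostContactMetric.IsKenmotsu

variable [T2Space M] {S : AlmostContactMetric E M}

theorem deform_nabla (hS : S.IsKenmotsu) (a : ℝ) (ha : 0 < a) {Y : VField E M} {x : M}
    (hY : DiffAt Y x) (v : TangentSpace 𝓘(ℝ, E) x) :
    leviCivita (S.deformMetric a ha) Y x v =
      leviCivita S.g Y x v + ((a - 1) / a * S.transverse x v (Y x)) • S.ξ x := by
  have LC := isLeviCivita_leviCivita S.g
  refine eq_leviCivita (S.deformMetric a ha)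
    (D := fun Y v ↦ leviCivita S.g Y x v + ((a - 1) / a * S.transverse x v (Y x)) • S.ξ x)
    (fun X Y hX hY ↦ ?_) (fun Y Z hY hZ v ↦ ?_) hY v
  · rw [← LC.torsion_free X Y x hX hY, S.transverse_symm x (Y x), add_sub_add_right_eq_sub]
  · have dg := mdifferentiableAt_inner S.g hY hZ
    have dT := S.mdifferentiableAt_transverse hY hZ
    have dag : MDifferentiableAt 𝓘(ℝ, E) 𝓘(ℝ, ℝ) (fun y ↦ a ^ 2 * S.g.inner y (Y y) (Z y)) x :=
      dg.const_smul (a ^ 2)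
    have daT : MDifferentiableAt 𝓘(ℝ, E) 𝓘(ℝ, ℝ)
        (fun y ↦ a * (a - 1) * S.transverse y (Y y) (Z y)) x := dT.const_smul (a * (a - 1))
    simp only [S.deformMetric_inner]
    rw [mvfderiv_fun_sub dag daT, mvfderiv_const_mul _ dg, mvfderiv_const_mul _ dT, sub_apply,
      smul_apply, smul_apply, LC.metric Y Z x hY hZ, hS.mvfderiv_transverse hY hZ]
    simp only [map_add, map_smul, add_apply, smul_apply, smul_eq_mul, S.transverse_ξ,
      S.transverse_symm x (S.ξ x), S.g.symm x (Y x) (S.ξ x), ← S.η_eq]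
    field_simp
    ring

theorem deform_nabla_nabla (hS : S.IsKenmotsu) (a : ℝ) (ha : 0 < a) {X Y Z : VField E M} {x : M}
    (hY : C2At Y x) (hZ : C2At Z x) :
    leviCivita (S.deformMetric a ha) (fun y ↦ leviCivita (S.deformMetric a ha) Z y (Y y)) x (X x) =
      leviCivita S.g (fun y ↦ leviCivita S.g Z y (Y y)) x (X x)
        + ((a - 1) / a * S.transverse x (Y x) (Z x)) • (X x - S.η x (X x) • S.ξ x)
        + ((a - 1) / a * (S.transverse x (X x) (leviCivita S.g Z x (Y x))
          + S.transverse x (leviCivita S.g Y x (X x)) (Z x)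
          + S.transverse x (Y x) (leviCivita S.g Z x (X x))
          - S.transverse x (X x) (Y x) * S.η x (Z x)
          - S.η x (Y x) * S.transverse x (X x) (Z x))) • S.ξ x := by
  let h : M → ℝ := fun y ↦ (a - 1) / a * S.transverse y (Y y) (Z y)
  have dξ := (S.smooth_ξ.c2At x).diffAt
  have dnabla := diffAt_leviCivita S.g hY hZ
  have dT := S.mdifferentiableAt_transverse hY.diffAt hZ.diffAt
  have dh : MDifferentiableAt 𝓘(ℝ, E) 𝓘(ℝ, ℝ) h x := mdifferentiableAt_const.mul dT
  have deform_nabla_near : (fun y ↦ leviCivita (S.deformMetric a ha) Z y (Y y)) =ᶠ[𝓝 x]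
      (fun y ↦ leviCivita S.g Z y (Y y)) + h • S.ξ := by
    filter_upwards [hZ.eventually] with y hZy
    exact hS.deform_nabla a ha hZy.diffAt (Y y)
  rw [leviCivita_congr _ (diffAt_leviCivita _ hY hZ) deform_nabla_near,
    hS.deform_nabla a ha (mdifferentiableAt_add_section dnabla (dh.smul_section dξ)),
    leviCivita_add S.g dnabla (dh.smul_section dξ), leviCivita_smul S.g dξ dh, hS.nabla_ξ,
    mvfderiv_const_mul _ dT, smul_apply, hS.mvfderiv_transverse hY.diffAt hZ.diffAt, Pi.add_apply,
    Pi.smul_apply', map_add, map_smul, transverse_ξ]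
  module

theorem deform_curv (hS : S.IsKenmotsu) (a : ℝ) (ha : 0 < a) {X Y Z : VField E M} {x : M}
    (hX : C2At X x) (hY : C2At Y x) (hZ : C2At Z x) :
    curv (S.deformMetric a ha) X Y Z x = curv S.g X Y Z x
      + ((a - 1) / a * S.transverse x (Y x) (Z x)) • X x
      - ((a - 1) / a * S.transverse x (X x) (Z x)) • Y x := by
  rw [curv, curv, hS.deform_nabla_nabla a ha hY hZ, hS.deform_nabla_nabla a ha hX hZ,
    hS.deform_nabla a ha hZ.diffAt,
    ← (isLeviCivita_leviCivita S.g).torsion_free _ _ x hX.diffAt hY.diffAt, map_sub, map_sub,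
    sub_apply, S.transverse_symm x (Y x) (X x)]
  module

theorem deform_ric (hS : S.IsKenmotsu) (a : ℝ) (ha : 0 < a) (x : M)
    (v w : TangentSpace 𝓘(ℝ, E) x) :
    ric (S.deformMetric a ha) x v w =
      ric S.g x v w + (finrank ℝ E - 1) * ((a - 1) / a) * S.transverse x v w := by
  have curvEnd_eq : curvEnd (S.deformMetric a ha) x v w = curvEnd S.g x v w
      + ((a - 1) / a * S.transverse x v w) • LinearMap.id
      - ((a - 1) / a) • (S.transverse x w).toLinearMap.smulRight v := by
    ext u
    have curv_eq := hS.deform_curv a ha (c2At_extend u) (c2At_extend v) (c2At_extend w)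
    simp only [extend_apply_self] at curv_eq
    simp [curvEnd, curv_eq, smul_smul, S.transverse_symm x w u]
  have finrank_eq : finrank ℝ (TangentSpace 𝓘(ℝ, E) x) = finrank ℝ E := rfl
  have : FiniteDimensional ℝ (TangentSpace 𝓘(ℝ, E) x) := inferInstanceAs (FiniteDimensional ℝ E)
  rw [ric_eq_trace, ric_eq_trace, curvEnd_eq, map_sub, map_add, map_smul, map_smul,
    LinearMap.trace_id, LinearMap.trace_smulRight, finrank_eq, smul_eq_mul, smul_eq_mul,
    ContinuousLinearMap.coe_coe, S.transverse_symm x w v]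
  ring

theorem nabla_nabla_ξ (hS : S.IsKenmotsu) {X Y : VField E M} {x : M} (hY : DiffAt Y x) :
    leviCivita S.g (fun y ↦ leviCivita S.g S.ξ y (Y y)) x (X x) =
      leviCivita S.g Y x (X x) - S.η x (Y x) • (X x - S.η x (X x) • S.ξ x)
        - (S.transverse x (X x) (Y x) + S.η x (leviCivita S.g Y x (X x))) • S.ξ x := by
  have dξ := (S.smooth_ξ.c2At x).diffAt
  have dη := S.mdifferentiableAt_η hY
  have dηξ : DiffAt ((fun y ↦ S.η y (Y y)) • S.ξ) x := dη.smul_section dξ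
  have nabla_ξ_Y : (fun y ↦ leviCivita S.g S.ξ y (Y y)) =
      Y + (-1 : ℝ) • (fun y ↦ S.η y (Y y)) • S.ξ := by
    ext1 y
    rw [hS.nabla_ξ, Pi.add_apply, Pi.smul_apply, Pi.smul_apply']
    module
  rw [nabla_ξ_Y, leviCivita_add S.g hY (dηξ.smul_const_section (a := -1)),
    leviCivita_const_smul S.g _ dηξ, leviCivita_smul S.g dξ dη, hS.nabla_ξ, hS.mvfderiv_η hY]
  module

theorem curv_ξ (hS : S.IsKenmotsu) {X Y : VField E M} {x : M} (hX : DiffAt X x)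
    (hY : DiffAt Y x) : curv S.g X Y S.ξ x = S.η x (X x) • Y x - S.η x (Y x) • X x := by
  rw [curv, hS.nabla_nabla_ξ hY, hS.nabla_nabla_ξ hX, hS.nabla_ξ,
    ← (isLeviCivita_leviCivita S.g).torsion_free _ _ x hX hY, S.transverse_symm x (Y x) (X x),
    map_sub]
  module

theorem ric_ξ (hS : S.IsKenmotsu) (x : M) : ric S.g x (S.ξ x) (S.ξ x) = -(finrank ℝ E - 1) := by
  have curvEnd_eq : curvEnd S.g x (S.ξ x) (S.ξ x) =
      (S.η x).toLinearMap.smulRight (S.ξ x) - LinearMap.id := by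
    ext u
    have hu := c2At_extend u
    have hξ := c2At_extend (S.ξ x)
    have curv_eq := hS.curv_ξ hu.diffAt hξ.diffAt
    rw [extend_apply_self, extend_apply_self, S.η_ξ, one_smul] at curv_eq
    exact (curv_congr_right S.g hu hξ hξ (S.smooth_ξ.c2At x)
      (extend_apply_self E (S.ξ x))).trans curv_eq
  have finrank_eq : finrank ℝ (TangentSpace 𝓘(ℝ, E) x) = finrank ℝ E := rfl
  have : FiniteDimensional ℝ (TangentSpace 𝓘(ℝ, E) x) := inferInstanceAs (FiniteDimensional ℝ E)
  rw [ric_eq_trace, curvEnd_eq, map_sub, LinearMap.trace_smulRight, LinearMap.trace_id, finrank_eq,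
    ContinuousLinearMap.coe_coe, S.η_ξ, neg_sub]

theorem deform_hess (hS : S.IsKenmotsu) (a : ℝ) (ha : 0 < a) {f : M → ℝ} {x : M}
    (hf : ContMDiffAt 𝓘(ℝ, E) 𝓘(ℝ, ℝ) 2 f x) (v w : TangentSpace 𝓘(ℝ, E) x) :
    hess (S.deformMetric a ha) f x v w =
      hess S.g f x v w - (a - 1) / a * S.transverse x v w * dirDeriv S.ξ f x := by
  have hw := diffAt_extend w
  have hess_vw := hess_eq S.g hf hw v
  have deform_hess_vw := hess_eq (S.deformMetric a ha) hf hw v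
  rw [extend_apply_self] at hess_vw deform_hess_vw
  rw [hess_vw, deform_hess_vw, hS.deform_nabla a ha hw, extend_apply_self, map_add, map_smul,
    dirDeriv, smul_eq_mul, sub_sub]

theorem hess_ξ (hS : S.IsKenmotsu) {f : M → ℝ} {x : M} (hf : ContMDiffAt 𝓘(ℝ, E) 𝓘(ℝ, ℝ) 2 f x) :
    hess S.g f x (S.ξ x) (S.ξ x) = dirDeriv S.ξ (dirDeriv S.ξ f) x := by
  rw [hess_eq S.g hf (S.smooth_ξ.c2At x).diffAt, hS.nabla_ξ, S.η_ξ, one_smul, sub_self, map_zero,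
    sub_zero, dirDeriv]

end AlmostContactMetric.IsKenmotsu

end Deformation

section Traceless

variable {E : Type*} [NormedAddCommGroup E] [NormedSpace ℝ E] [FiniteDimensional ℝ E]
  {M : Type*} [TopologicalSpace M] [ChartedSpace E M] [IsManifold 𝓘(ℝ, E) ∞ M]

theorem sum_inner_mul_apply_frame (g : Metric E M) (x : M) (z : TangentSpace 𝓘(ℝ, E) x)
    (α : TangentSpace 𝓘(ℝ, E) x →L[ℝ] ℝ) :
    ∑ i, g.inner x z (frame g x i) * α (frame g x i) = α z := by
  conv_rhs => rw [← sum_inner_frame_smul g x z]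
  simp only [map_sum, map_smul, smul_eq_mul]

theorem sum_sum_inner_mul_apply_frame (g : Metric E M) (x : M) (z : TangentSpace 𝓘(ℝ, E) x)
    (H : TangentSpace 𝓘(ℝ, E) x →L[ℝ] TangentSpace 𝓘(ℝ, E) x →L[ℝ] ℝ) :
    ∑ i, ∑ j, g.inner x z (frame g x i) * g.inner x z (frame g x j) *
      H (frame g x i) (frame g x j) = H z z := by
  have expand_left := congrArg (fun v ↦ H v z) (sum_inner_frame_smul g x z)
  simp only [mul_assoc, ← Finset.mul_sum, sum_inner_mul_apply_frame]
  simpa only [map_sum, map_smul, sum_apply, smul_apply, smul_eq_mul] using expand_left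

variable {g : Metric E M} {x : M} {z : TangentSpace 𝓘(ℝ, E) x} {u b : ℝ}
  {R : TangentSpace 𝓘(ℝ, E) x → TangentSpace 𝓘(ℝ, E) x → ℝ}

theorem traceAt_of_eq_neg_add {H : TangentSpace 𝓘(ℝ, E) x → TangentSpace 𝓘(ℝ, E) x → ℝ}
    (hz : g.inner x z z = 1)
    (hR : ∀ v w, R v w = -H v w + u * g.inner x v w + b * (g.inner x z v * g.inner x z w)) :
    traceAt g x R = -traceAt g x H + finrank ℝ E * u + b := by
  simp only [traceAt, hR, inner_frame, Finset.sum_add_distrib, Finset.sum_neg_distrib,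
    ← Finset.mul_sum, sum_inner_mul_apply_frame, hz]
  simp [mul_comm u]

theorem normSqAt_of_eq_neg_add
    {H : TangentSpace 𝓘(ℝ, E) x →L[ℝ] TangentSpace 𝓘(ℝ, E) x →L[ℝ] ℝ}
    (hz : g.inner x z z = 1)
    (hR : ∀ v w, R v w = -H v w + u * g.inner x v w + b * (g.inner x z v * g.inner x z w)) :
    normSqAt g x R = normSqAt g x (fun v w ↦ H v w) - 2 * u * traceAt g x (fun v w ↦ H v w)
      - 2 * b * H z z + finrank ℝ E * u ^ 2 + 2 * u * b + b ^ 2 := by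
  let e := frame g x
  let c i := g.inner x z (e i)
  have sum_sq_c : ∑ i, c i * c i = 1 := (sum_inner_mul_apply_frame g x z _).trans hz
  have sum_sum_c : ∑ i, ∑ j, c i * c j * H (e i) (e j) = H z z :=
    sum_sum_inner_mul_apply_frame g x z H
  have sq_entry : ∀ i j, R (e i) (e j) ^ 2 = H (e i) (e j) ^ 2
      - 2 * b * (c i * c j * H (e i) (e j)) + b ^ 2 * (c i * c i * (c j * c j))
      + if i = j then u ^ 2 - 2 * u * H (e i) (e i) + 2 * u * b * (c i * c i) else 0 := by
    intro i j
    rw [hR, inner_frame]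
    split_ifs with hij
    · subst hij
      ring
    · ring
  change ∑ i, ∑ j, R (e i) (e j) ^ 2 = ∑ i, ∑ j, H (e i) (e j) ^ 2
    - 2 * u * ∑ i, H (e i) (e i) - _ + _ + _ + _
  simp only [sq_entry, Finset.sum_add_distrib, Finset.sum_sub_distrib, ← Finset.mul_sum,
    Finset.sum_ite_eq, Finset.mem_univ, if_true, sum_sum_c, sum_sq_c, mul_one, Finset.sum_const,
    Finset.card_univ, Fintype.card_fin, nsmul_eq_mul]
  ring

/-- The term `u • g` does not contribute: both sides are `dim M` times the squared norm of a
trace-free tensor. -/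
theorem finrank_mul_normSqAt_sub_sq_traceAt_of_eq_neg_add
    {H : TangentSpace 𝓘(ℝ, E) x →L[ℝ] TangentSpace 𝓘(ℝ, E) x →L[ℝ] ℝ}
    (hz : g.inner x z z = 1)
    (hR : ∀ v w, R v w = -H v w + u * g.inner x v w + b * (g.inner x z v * g.inner x z w)) :
    finrank ℝ E * normSqAt g x R - traceAt g x R ^ 2 =
      finrank ℝ E * normSqAt g x (fun v w ↦ H v w) - traceAt g x (fun v w ↦ H v w) ^ 2
        - 2 * b * (finrank ℝ E * H z z - traceAt g x (fun v w ↦ H v w))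
        + b ^ 2 * (finrank ℝ E - 1) := by
  rw [normSqAt_of_eq_neg_add hz hR, traceAt_of_eq_neg_add hz hR]
  ring

end Traceless

section Soliton

variable {E : Type*} [NormedAddCommGroup E] [NormedSpace ℝ E] [FiniteDimensional ℝ E]
  {M : Type*} [TopologicalSpace M] [T2Space M] [ChartedSpace E M] [IsManifold 𝓘(ℝ, E) ∞ M]

theorem IsAlmostRicciSoliton.ric_eq {g : Metric E M} {f lam : M → ℝ}
    (h : IsAlmostRicciSoliton g (grad g f) lam) {x : M}
    (hf : ContMDiffAt 𝓘(ℝ, E) 𝓘(ℝ, ℝ) 2 f x) (v w : TangentSpace 𝓘(ℝ, E) x) :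
    ric g x v w = -hess g f x v w + lam x * g.inner x v w := by
  obtain ⟨X, hX, rfl⟩ := exists_isSmooth_eq x v
  obtain ⟨Y, hY, rfl⟩ := exists_isSmooth_eq x w
  have equation := h.equation X Y hX hY x
  rw [lieMetric_grad g hf (hX.c2At x).diffAt (hY.c2At x).diffAt] at equation
  linarith

namespace AlmostContactMetric.IsKenmotsu

variable {S : AlmostContactMetric E M} {a : ℝ} {ha : 0 < a} {f lam : M → ℝ} {x : M}

theorem ric_add_hess_of_soliton (hS : S.IsKenmotsu) (hf : ContMDiffAt 𝓘(ℝ, E) 𝓘(ℝ, ℝ) 2 f x)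
    (hsol : IsAlmostRicciSoliton (S.deform a ha).g (grad (S.deform a ha).g f) lam)
    (v w : TangentSpace 𝓘(ℝ, E) x) :
    ric S.g x v w + hess S.g f x v w = a ^ 2 * lam x * S.g.inner x v w
      + (a - 1) / a * (dirDeriv S.ξ f x - (finrank ℝ E - 1) - a ^ 2 * lam x)
        * S.transverse x v w := by
  have deformed : ric (S.deformMetric a ha) x v w =
      -hess (S.deformMetric a ha) f x v w + lam x * (S.deformMetric a ha).inner x v w :=
    hsol.ric_eq hf v w
  rw [hS.deform_ric, hS.deform_hess a ha hf, S.deformMetric_inner] at deformed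
  have cancel_a : (a - 1) / a * a ^ 2 = a * (a - 1) := by
    field_simp
  linear_combination deformed + lam x * S.transverse x v w * cancel_a

theorem sq_mul_lam_of_soliton (hS : S.IsKenmotsu) (hf : ContMDiffAt 𝓘(ℝ, E) 𝓘(ℝ, ℝ) 2 f x)
    (hsol : IsAlmostRicciSoliton (S.deform a ha).g (grad (S.deform a ha).g f) lam) :
    a ^ 2 * lam x = dirDeriv S.ξ (dirDeriv S.ξ f) x - (finrank ℝ E - 1) := by
  have at_ξ := hS.ric_add_hess_of_soliton hf hsol (S.ξ x) (S.ξ x)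
  rw [hS.ric_ξ, hS.hess_ξ hf, S.transverse_ξ, ← S.η_eq, S.η_ξ] at at_ξ
  linarith

theorem ric_of_soliton (hS : S.IsKenmotsu) (hf : ContMDiffAt 𝓘(ℝ, E) 𝓘(ℝ, ℝ) 2 f x)
    (hsol : IsAlmostRicciSoliton (S.deform a ha).g (grad (S.deform a ha).g f) lam)
    (v w : TangentSpace 𝓘(ℝ, E) x) :
    ric S.g x v w = -hess S.g f x v w
      + (dirDeriv S.ξ (dirDeriv S.ξ f) x - (finrank ℝ E - 1)) * S.g.inner x v w
      + (a - 1) / a * (dirDeriv S.ξ f x - dirDeriv S.ξ (dirDeriv S.ξ f) x)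
        * S.transverse x v w := by
  have ric_add_hess := hS.ric_add_hess_of_soliton hf hsol v w
  rw [hS.sq_mul_lam_of_soliton hf hsol] at ric_add_hess
  linear_combination ric_add_hess

theorem finrank_mul_normSqAt_ric_of_soliton (hS : S.IsKenmotsu)
    (hf : ContMDiffAt 𝓘(ℝ, E) 𝓘(ℝ, ℝ) 2 f x)
    (hsol : IsAlmostRicciSoliton (S.deform a ha).g (grad (S.deform a ha).g f) lam) :
    finrank ℝ E * normSqAt S.g x (ric S.g x) - scal S.g x ^ 2 =
      finrank ℝ E * normSqAt S.g x (hess S.g f x) - laplacian S.g f x ^ 2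
        - 2 * ((a - 1) / a * (dirDeriv S.ξ (dirDeriv S.ξ f) x - dirDeriv S.ξ f x))
          * (finrank ℝ E * dirDeriv S.ξ (dirDeriv S.ξ f) x - laplacian S.g f x)
        + ((a - 1) / a * (dirDeriv S.ξ (dirDeriv S.ξ f) x - dirDeriv S.ξ f x)) ^ 2
          * (finrank ℝ E - 1) := by
  have inner_ξ_ξ : S.g.inner x (S.ξ x) (S.ξ x) = 1 := (S.η_eq x _).symm.trans (S.η_ξ x)
  rw [← hS.hess_ξ hf]
  refine finrank_mul_normSqAt_sub_sq_traceAt_of_eq_neg_add (z := S.ξ x)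
    (H := (S.g.inner x).comp (leviCivita S.g (grad S.g f) x))
    (u := hess S.g f x (S.ξ x) (S.ξ x) - (finrank ℝ E - 1)
      + (a - 1) / a * (dirDeriv S.ξ f x - hess S.g f x (S.ξ x) (S.ξ x)))
    inner_ξ_ξ fun v w ↦ ?_
  rw [hS.ric_of_soliton hf hsol, S.transverse_apply, S.η_eq, S.η_eq, hS.hess_ξ hf,
    ContinuousLinearMap.comp_apply, ← hess]
  ring

end AlmostContactMetric.IsKenmotsu

end Soliton

end Kenmotsu

theorem mainTheorem10_general (n : ℕ) {E : Type*} [NormedAddCommGroup E] [NormedSpace ℝ E]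
    [FiniteDimensional ℝ E] (hE : finrank ℝ E = 2 * n + 1) {M : Type*} [TopologicalSpace M]
    [T2Space M] [ChartedSpace E M] [IsManifold 𝓘(ℝ, E) ∞ M]
    (S : AlmostContactMetric E M) (hS : S.IsKenmotsu)
    (a : ℝ) (ha : 0 < a) (f : M → ℝ) (lam : M → ℝ)
    (hsol : IsAlmostRicciSoliton (S.deform a ha).g (grad (S.deform a ha).g f) lam) (x : M)
    (hf : ContMDiffAt 𝓘(ℝ, E) 𝓘(ℝ, ℝ) 2 f x) :
    normSqAt S.g x (ric S.g x) ≥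
      normSqAt S.g x (hess S.g f x)
        - 4 * n * ((a - 1) / a) * scal S.g x
        - 4 * n ^ 2 * (2 * n + 1) * ((a - 1) / a) ^ 2
        - 1 / (2 * n + 1) * laplacian S.g f x ^ 2
        - 2 / (2 * n + 1) * ((a - 1) / a) *
            (dirDeriv S.ξ f x - dirDeriv S.ξ (dirDeriv S.ξ f) x) * laplacian S.g f x
        + 2 * (2 * n + a) * (a - 1) / ((2 * n + 1) * a ^ 2) *
            (dirDeriv S.ξ f x * dirDeriv S.ξ (dirDeriv S.ξ f) x)
        + 2 * n / (2 * n + 1) * ((a - 1) / a) ^ 2 * dirDeriv S.ξ f x ^ 2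
        - 2 * (n + n * a + a) * (a - 1) / ((2 * n + 1) * a ^ 2) *
            dirDeriv S.ξ (dirDeriv S.ξ f) x ^ 2 := by
  have traceless_identity := hS.finrank_mul_normSqAt_ric_of_soliton hf hsol
  have finrank_eq : (finrank ℝ E : ℝ) = 2 * n + 1 := by exact_mod_cast hE
  rw [finrank_eq] at traceless_identity
  have square_nonneg :
      0 ≤ (scal S.g x + 2 * n * (2 * n + 1) * ((a - 1) / a)) ^ 2 / (2 * n + 1) := by positivity
  rw [ge_iff_le, ← sub_nonneg]
  refine square_nonneg.trans_eq ?_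
  field_simp at traceless_identity ⊢
  linear_combination -traceless_identity

theorem mainTheorem10 (n : ℕ) {M : Type*} [TopologicalSpace M] [T2Space M]
    [ChartedSpace (EuclideanSpace ℝ (Fin (2 * n + 1))) M] [IsManifold (𝓡 (2 * n + 1)) ∞ M]
    (S : AlmostContactMetric (EuclideanSpace ℝ (Fin (2 * n + 1))) M) (hS : S.IsKenmotsu)
    (a : ℝ) (ha : 0 < a) (f : M → ℝ) (hf : ContMDiff (𝓡 (2 * n + 1)) 𝓘(ℝ, ℝ) ∞ f)
    (lam : M → ℝ)
    (hsol : IsAlmostRicciSoliton (S.deform a ha).g (grad (S.deform a ha).g f) lam) (x : M) :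
    normSqAt S.g x (ric S.g x) ≥
      normSqAt S.g x (hess S.g f x)
        - 4 * n * ((a - 1) / a) * scal S.g x
        - 4 * n ^ 2 * (2 * n + 1) * ((a - 1) / a) ^ 2
        - 1 / (2 * n + 1) * laplacian S.g f x ^ 2
        - 2 / (2 * n + 1) * ((a - 1) / a) *
            (dirDeriv S.ξ f x - dirDeriv S.ξ (dirDeriv S.ξ f) x) * laplacian S.g f x
        + 2 * (2 * n + a) * (a - 1) / ((2 * n + 1) * a ^ 2) *
            (dirDeriv S.ξ f x * dirDeriv S.ξ (dirDeriv S.ξ f) x)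
        + 2 * n / (2 * n + 1) * ((a - 1) / a) ^ 2 * dirDeriv S.ξ f x ^ 2
        - 2 * (n + n * a + a) * (a - 1) / ((2 * n + 1) * a ^ 2) *
            dirDeriv S.ξ (dirDeriv S.ξ f) x ^ 2 :=
  mainTheorem10_general n (by simp) S hS a ha f lam hsol x ((hf x).of_le ENat.LEInfty.out)
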